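/- Let $\mathbb K$ be an algebraically closed field of characteristic $0$; all vector spaces are over $\mathbb K$ and may be infinite-dimensional. For a vector space $E$ and $p\ge 0$ let $C^p(E,E)$ be the space of linear maps $\wedge^2E\otimes\stackrel{(p)}{\cdots}\otimes\wedge^2E\wedge E\to E$, i.e. of maps $\alpha(\mathfrak X_1,\dots,\mathfrak X_p,x)$, with $\mathfrak X_i=x_i\wedge y_i$, that are multilinear in $x_1,y_1,\dots,x_p,y_p,x$, alternating in each pair $(x_i,y_i)$ and, if $p\ge1$, alternating in the last triple $(x_p,y_p,x)$. For $\alpha\in C^p(E,E)$ and $\beta\in C^q(E,E)$ put $$[\alpha,\beta]=(-1)^{pq}\,\alpha\circ\beta-\beta\circ\alpha\in C^{p+q}(E,E),$$ where $$\begin{aligned}\alpha\circ\beta(\mathfrak X_1,\dots,\mathfrak X_{p+q},x)=&\sum_{J,\;j_{q+1}<p+q+1}(-1)^{(J,I)}(-1)^k\Big(\alpha(\mathfrak X_{i_1},\dots,\mathfrak X_{i_k},\beta(\mathfrak X_{j_1},\dots,\mathfrak X_{j_q},x_{j_{q+1}})\wedge y_{j_{q+1}},\mathfrak X_{i_{k+1}},\dots,\mathfrak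 X_{i_{p-1}},x)\\&\qquad+\alpha(\mathfrak X_{i_1},\dots,\mathfrak X_{i_k},x_{j_{q+1}}\wedge\beta(\mathfrak X_{j_1},\dots,\mathfrak X_{j_q},y_{j_{q+1}}),\mathfrak X_{i_{k+1}},\dots,\mathfrak X_{i_{p-1}},x)\Big)\\&+\sum_{J,\;j_{q+1}=p+q+1}(-1)^{(J,I)}(-1)^p\,\alpha(\mathfrak X_{i_1},\dots,\mathfrak X_{i_p},\beta(\mathfrak X_{j_1},\dots,\mathfrak X_{j_q},x)).\end{aligned}$$ Here $J=\{j_1<\dots<j_{q+1}\}$ runs over the $(q+1)$-element subsets of $\{1,\dots,p+q+1\}$, $I=\{i_1<\dots<i_p\}$ is its complement, $(-1)^{(J,I)}$ is the sign of the permutation $(j_1,\dots,j_{q+1},i_1,\dots,i_p)$, and $k$ is the number of elements of $I$ smaller than $j_{q+1}$. Let $(\mathfrak g,\pi=[\cdot,\cdot,\cdot])$ be a $3$-Lie algebra: $\pi$ is trilinear, alternating, and satisfies $$[x_1,x_2,[x_3,x_4,x_5]]=[[x_1,x_2,x_3],x_4,x_5]+[x_3,[x_1,x_2,x_4],x_5]+[x_3,x_4,[x_1,x_2,x_5]].$$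 Let $(V;\rho,\nu)$ be a generalized representation of $\mathfrak g$, i.e. a vector space $V$ with linear maps $\rho:\wedge^2\mathfrak g\to\mathfrak{gl}(V)$ and $\nu:\mathfrak g\to\mathrm{Hom}(\wedge^2V,V)$ such that $[\pi+\bar\rho+\bar\nu,\,\pi+\bar\rho+\bar\nu]=0$ for the bracket on the spaces $C^\bullet(\mathfrak g\oplus V,\mathfrak g\oplus V)$, where, for $x,y,z\in\mathfrak g$ and $u,v,w\in V$, $$\begin{aligned}\pi(x+u,y+v,z+w)&=[x,y,z],\\ \bar\rho(x+u,y+v,z+w)&=\rho(x,y)(w)+\rho(y,z)(u)+\rho(z,x)(v),\\ \bar\nu(x+u,y+v,z+w)&=\nu(x)(v\wedge w)+\nu(y)(w\wedge u)+\nu(z)(u\wedge v).\end{aligned}$$ Let $C^p_>(\mathfrak g\oplus V,V)\subseteq C^p(\mathfrak g\oplus V,\mathfrak g\oplus V)$ be the space of those cochains that take values in $V$ and vanish when all their arguments lie in $V$, so that $C^p(\mathfrak g\oplus V,V)=C^p_>(\mathfrak g\oplus V,V)\oplus C^p(V,V)$. Then $\mathrm d(\alpha)=[\pi+\bar\rho+\bar\nu,\alpha]$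 defines linear maps $\mathrm d:C^p_>(\mathfrak g\oplus V,V)\to C^{p+1}_>(\mathfrak g\oplus V,V)$, $p\ge0$, and $$\mathrm d\circ\mathrm d=0.$$ Thus one obtains a cochain complex, whose space of $p$-cochains, $p\ge1$, is $C^{p-1}_>(\mathfrak g\oplus V,V)$. For $p\ge1$ let $\mathcal Z^p(\mathfrak g;V)$ be the space of $p$-cocycles, the kernel of $\mathrm d$ on $C^{p-1}_>(\mathfrak g\oplus V,V)$, and $\mathcal B^p(\mathfrak g;V)$ the space of $p$-coboundaries, the image of $\mathrm d$ in $C^{p-1}_>(\mathfrak g\oplus V,V)$ (so $\mathcal B^1(\mathfrak g;V)=0$). Then $\mathcal B^p(\mathfrak g;V)\subseteq\mathcal Z^p(\mathfrak g;V)$, and the cohomology of this complex in degree $p$ is $\mathcal H^p(\mathfrak g;V)=\mathcal Z^p(\mathfrak g;V)/\mathcal B^p(\mathfrak g;V)$. -/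

import Mathlib

set_option maxSynthPendingDepth 3

/-- A 3-Lie algebra structure on `g`. -/
structure ThreeLieAlgebra (K g : Type*) [Field K] [AddCommGroup g] [Module K g] where
  br : g [⋀^Fin 3]→ₗ[K] g
  fundamental : ∀ x₁ x₂ x₃ x₄ x₅ : g,
    br ![x₁, x₂, br ![x₃, x₄, x₅]] =
      br ![br ![x₁, x₂, x₃], x₄, x₅] + br ![x₃, br ![x₁, x₂, x₄], x₅]
        + br ![x₃, x₄, br ![x₁, x₂, x₅]]

namespace ThreeLie

open Function

section Cochains

variable {K E : Type*} [Field K] [AddCommGroup E] [Module K E]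

/-- `f` is (the function of `(x₁, y₁), …, (x_p, y_p), z` given by) a linear map
`∧²E ⊗ ⋯ ⊗ ∧²E ∧ E → E`, with `p` factors `∧²E`: it is linear in each of its `2p + 1` arguments,
alternating in each pair `(x_i, y_i)`, and alternating in the last triple `(x_p, y_p, z)`. -/
structure IsCochain (K : Type*) {E : Type*} [Field K] [AddCommGroup E] [Module K E] {p : ℕ}
    (f : (Fin p → E × E) → E → E) : Prop where
  linear_fst : ∀ X i y z, IsLinearMap K fun x => f (update X i (x, y)) z
  linear_snd : ∀ X i x z, IsLinearMap K fun y => f (update X i (x, y)) z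
  linear_last : ∀ X, IsLinearMap K (f X)
  alt : ∀ X i x z, f (update X i (x, x)) z = 0
  alt_last : ∀ X (i : Fin p) x y, (i : ℕ) + 1 = p → f (update X i (x, y)) y = 0

/-- The space `C^p(E, E) = Hom(∧²E ⊗ ⋯ ⊗ ∧²E ∧ E, E)`, with `p` factors `∧²E`. -/
def Cochain (K E : Type*) [Field K] [AddCommGroup E] [Module K E] (p : ℕ) :
    Submodule K ((Fin p → E × E) → E → E) where
  carrier := {f | IsCochain K f}
  zero_mem' := by
    constructor <;> intros <;> first | rfl | exact ⟨by simp, by simp⟩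
  add_mem' := by
    intro f f' hf hf'
    constructor
    · exact fun X i y z =>
        (IsLinearMap.mk' _ (hf.linear_fst X i y z) + IsLinearMap.mk' _ (hf'.linear_fst X i y z)).isLinear
    · exact fun X i y z =>
        (IsLinearMap.mk' _ (hf.linear_snd X i y z) + IsLinearMap.mk' _ (hf'.linear_snd X i y z)).isLinear
    · exact fun X =>
        (IsLinearMap.mk' _ (hf.linear_last X) + IsLinearMap.mk' _ (hf'.linear_last X)).isLinear
    · intro X i x z; simp [hf.alt, hf'.alt]
    · intro X i x y h; simp [hf.alt_last X i x y h, hf'.alt_last X i x y h]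
  smul_mem' := by
    intro c f hf
    constructor
    · exact fun X i y z => (c • IsLinearMap.mk' _ (hf.linear_fst X i y z)).isLinear
    · exact fun X i y z => (c • IsLinearMap.mk' _ (hf.linear_snd X i y z)).isLinear
    · exact fun X => (c • IsLinearMap.mk' _ (hf.linear_last X)).isLinear
    · intro X i x z; simp [hf.alt]
    · intro X i x y h; simp [hf.alt_last X i x y h]

/-! ### The product `∘` -/

/-- The sign `(-1)^{(J, I)}` of the shuffle that lists `J` and then its complement `I`, both in
increasing order: its inversions are the pairs `j ∈ J`, `i ∈ I` with `i < j`. -/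
def shuffleSign {n : ℕ} (J : Finset (Fin n)) : ℤ :=
  (-1) ^ ((J ×ˢ Jᶜ).filter fun x => x.2 < x.1).card

/-- `(s_1, …, s_k, Y, s_{k+1}, …, s_{p-1})`. -/
def insertAt {A : Type*} {p : ℕ} (k : ℕ) (Y : A) (s : Fin p → A) : Fin p → A := fun a =>
  if (a : ℕ) < k then s a
  else if (a : ℕ) = k then Y
  else s ⟨a - 1, (Nat.sub_le _ _).trans_lt a.2⟩

theorem card_compl_of {p q n : ℕ} (h : p + q = n) {J : Finset (Fin (n + 1))}
    (hJ : J.card = q + 1) : Jᶜ.card = p := by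
  rw [Finset.card_compl, Fintype.card_fin, hJ]; omega

/-- The summand of `α ∘ β` for the subset `J = {j_1 < ⋯ < j_{q+1}}` of the `n + 1 = p + q + 1`
argument places, with complement `I = {i_1 < ⋯ < i_p}`. The family `Z` extends `X` by
an entry with first component `z` at the last place. -/
def circTerm {p q n : ℕ} (h : p + q = n) (α : (Fin p → E × E) → E → E)
    (β : (Fin q → E × E) → E → E) (X : Fin n → E × E) (z : E)
    (J : {J : Finset (Fin (n + 1)) // J.card = q + 1}) : E :=
  let Z : Fin (n + 1) → E × E := Fin.snoc X (z, 0)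
  let j := J.1.orderEmbOfFin J.2
  let i := J.1ᶜ.orderEmbOfFin (card_compl_of h J.2)
  let m := j (Fin.last q)
  let B : E → E := β fun b => Z (j b.castSucc)
  let k := (J.1ᶜ.filter fun i => i < m).card
  if m = Fin.last n then
    (shuffleSign J.1 * (-1) ^ p) • α (fun a => Z (i a)) (B z)
  else
    (shuffleSign J.1 * (-1) ^ k) •
      (α (insertAt k (B (Z m).1, (Z m).2) fun a => Z (i a)) z
        + α (insertAt k ((Z m).1, B (Z m).2) fun a => Z (i a)) z)

/-- The product `α ∘ β` of `α` of degree `p` and `β` of degree `q`, as a function. -/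
def circFun {p q n : ℕ} (h : p + q = n) (α : (Fin p → E × E) → E → E)
    (β : (Fin q → E × E) → E → E) (X : Fin n → E × E) (z : E) : E :=
  ∑ J : {J : Finset (Fin (n + 1)) // J.card = q + 1}, circTerm h α β X z J

/-! #### `α ∘ β` is a cochain -/

/-- The sum of the summands of `α ∘ β` that share `j_1 < ⋯ < j_q`, up to sign. -/
def derivSum {p q : ℕ} (α : (Fin p → E × E) → E → E) (β : (Fin q → E × E) → E → E)
    (P : Finset (Fin p)) (A : Fin p → E × E) (B : Fin q → E × E) (z : E) : E :=
  α A (β B z) + ∑ a ∈ P, (α (update A a (β B (A a).1, (A a).2)) z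
    + α (update A a ((A a).1, β B (A a).2)) z)

namespace IsCochain

variable {p q : ℕ} {α : (Fin p → E × E) → E → E} {β : (Fin q → E × E) → E → E}

theorem skew (hα : IsCochain K α) (X : Fin p → E × E) (i : Fin p) (x y z : E) :
    α (update X i (x, y)) z + α (update X i (y, x)) z = 0 := by
  have h := hα.alt X i (x + y) z
  rw [(hα.linear_fst X i (x + y) z).map_add, (hα.linear_snd X i x z).map_add,
    (hα.linear_snd X i y z).map_add, hα.alt, hα.alt] at h
  simpa using h

theorem skew_last (hα : IsCochain K α) (X : Fin p → E × E) (i : Fin p) (hi : (i : ℕ) + 1 = p)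
    (x y z : E) : α (update X i (x, y)) z + α (update X i (x, z)) y = 0 := by
  have h := hα.alt_last X i x (y + z) hi
  rw [(hα.linear_snd X i x (y + z)).map_add, (hα.linear_last _).map_add,
    (hα.linear_last _).map_add, hα.alt_last _ _ _ _ hi, hα.alt_last _ _ _ _ hi] at h
  simpa using h

theorem zero_fst (hα : IsCochain K α) (X : Fin p → E × E) (i : Fin p) (y z : E) :
    α (update X i (0, y)) z = 0 := (hα.linear_fst X i y z).map_zero

theorem zero_snd (hα : IsCochain K α) (X : Fin p → E × E) (i : Fin p) (y z : E) :
    α (update X i (y, 0)) z = 0 := (hα.linear_snd X i y z).map_zero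

theorem zero_last (hα : IsCochain K α) (X : Fin p → E × E) : α X 0 = 0 :=
  (hα.linear_last X).map_zero

/-- If `B` depends linearly on `v` through `β`, so does `derivSum`. -/
theorem derivSum_linear_right (hα : IsCochain K α) (P : Finset (Fin p)) (A : Fin p → E × E)
    (z : E) (B : E → Fin q → E × E) (hB : ∀ w, IsLinearMap K fun v => β (B v) w) :
    IsLinearMap K fun v => derivSum α β P A (B v) z := by
  constructor
  · intro v v'
    simp only [derivSum, (hB _).map_add, (hα.linear_last _).map_add,
      (hα.linear_fst _ _ _ _).map_add, (hα.linear_snd _ _ _ _).map_add, Finset.sum_add_distrib]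
    abel
  · intro c v
    simp only [derivSum, (hB _).map_smul, (hα.linear_last _).map_smul,
      (hα.linear_fst _ _ _ _).map_smul, (hα.linear_snd _ _ _ _).map_smul, smul_add,
      Finset.smul_sum]

theorem derivSum_linear_last (hα : IsCochain K α) (hβ : IsCochain K β) (P : Finset (Fin p))
    (A : Fin p → E × E) (B : Fin q → E × E) : IsLinearMap K (derivSum α β P A B) := by
  constructor
  · intro v v'
    simp only [derivSum, (hβ.linear_last _).map_add, (hα.linear_last _).map_add,
      Finset.sum_add_distrib]
    abel
  · intro c v
    simp only [derivSum, (hβ.linear_last _).map_smul, (hα.linear_last _).map_smul, smul_add,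
      Finset.smul_sum]

theorem derivSum_linear_fst (hα : IsCochain K α) (hβ : IsCochain K β) (P : Finset (Fin p))
    (A : Fin p → E × E) (B : Fin q → E × E) (b : Fin p) (y z : E) :
    IsLinearMap K fun x => derivSum α β P (update A b (x, y)) B z := by
  have key : ∀ a, IsLinearMap K fun x =>
      α (update (update A b (x, y)) a (β B (update A b (x, y) a).1, (update A b (x, y) a).2)) z
      + α (update (update A b (x, y)) a ((update A b (x, y) a).1, β B (update A b (x, y) a).2)) z := by
    intro a
    by_cases hab : a = b
    · subst hab
      constructor
      · intro v v'
        simp only [update_self, update_idem, (hβ.linear_last _).map_add,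
          (hα.linear_fst _ _ _ _).map_add]
        abel
      · intro c v
        simp only [update_self, update_idem, (hβ.linear_last _).map_smul,
          (hα.linear_fst _ _ _ _).map_smul, smul_add]
    · constructor
      · intro v v'
        simp only [update_of_ne hab, update_comm (Ne.symm hab), (hα.linear_fst _ _ _ _).map_add]
        abel
      · intro c v
        simp only [update_of_ne hab, update_comm (Ne.symm hab), (hα.linear_fst _ _ _ _).map_smul,
          smul_add]
  constructor
  · intro v v'
    simp only [derivSum, (key _).map_add, (hα.linear_fst _ _ _ _).map_add]
    rw [Finset.sum_add_distrib]
    abel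
  · intro c v
    simp only [derivSum, (key _).map_smul, (hα.linear_fst _ _ _ _).map_smul]
    rw [← Finset.smul_sum, smul_add]

theorem derivSum_alt (hα : IsCochain K α) (P : Finset (Fin p))
    (A : Fin p → E × E) (B : Fin q → E × E) (b : Fin p) (x z : E) :
    derivSum α β P (update A b (x, x)) B z = 0 := by
  unfold derivSum
  rw [hα.alt, zero_add]
  refine Finset.sum_eq_zero fun a _ => ?_
  by_cases hab : a = b
  · subst hab
    simp only [update_self, update_idem]
    exact hα.skew _ _ _ _ _
  · simp only [update_of_ne hab, update_comm (Ne.symm hab), hα.alt, add_zero]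

/-- `derivSum` is skew-symmetric in the pairs. -/
theorem derivSum_skew (hα : IsCochain K α) (P : Finset (Fin p))
    (A : Fin p → E × E) (B : Fin q → E × E) (b : Fin p) (x y z : E) :
    derivSum α β P (update A b (x, y)) B z = -derivSum α β P (update A b (y, x)) B z := by
  have hs : ∀ (X : Fin p → E × E) (i : Fin p) (x y z : E),
      α (update X i (x, y)) z = -α (update X i (y, x)) z := fun X i x y z =>
    eq_neg_of_add_eq_zero_left (hα.skew X i x y z)
  unfold derivSum
  rw [neg_add, ← Finset.sum_neg_distrib, hs A b x y]
  refine congrArg _ (Finset.sum_congr rfl fun a _ => ?_)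
  by_cases hab : a = b
  · subst hab
    simp only [update_self, update_idem]
    rw [hs _ _ _ y, hs _ _ x]
    abel
  · simp only [update_of_ne hab, update_comm (Ne.symm hab)]
    rw [hs _ b x y, hs _ b x y]
    abel

theorem derivSum_alt_last (hα : IsCochain K α) (P : Finset (Fin p))
    (A : Fin p → E × E) (B : Fin q → E × E) (b : Fin p) (hb : (b : ℕ) + 1 = p) (hP : b ∈ P)
    (x y : E) : derivSum α β P (update A b (x, y)) B y = 0 := by
  unfold derivSum
  rw [Finset.sum_eq_single b]
  · simp only [update_self, update_idem]
    rw [hα.alt_last _ _ _ _ hb, zero_add]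
    exact hα.skew_last _ _ hb _ _ _
  · intro a _ hab
    simp only [update_of_ne hab, update_comm (Ne.symm hab), hα.alt_last _ _ _ _ hb, add_zero]
  · exact fun h => absurd hP h

theorem derivSum_linear_snd (hα : IsCochain K α) (hβ : IsCochain K β) (P : Finset (Fin p))
    (A : Fin p → E × E) (B : Fin q → E × E) (b : Fin p) (x z : E) :
    IsLinearMap K fun y => derivSum α β P (update A b (x, y)) B z := by
  simp_rw [hα.derivSum_skew P A B b x]
  exact (-IsLinearMap.mk' _ (hα.derivSum_linear_fst hβ P A B b x z)).isLinear

end IsCochain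

section Reindex

variable {p q n : ℕ}

theorem card_compl_of' (h : p + q = n) {S : Finset (Fin n)} (hS : S.card = q) : Sᶜ.card = p := by
  rw [Finset.card_compl, Fintype.card_fin, hS]; omega

/-- `J = S ∪ {m}`. -/
def addMax (S : Finset (Fin n)) (m : Fin (n + 1)) : Finset (Fin (n + 1)) :=
  insert m (S.map Fin.castSuccEmb)

theorem mem_addMax {S : Finset (Fin n)} {m t : Fin (n + 1)} :
    t ∈ addMax S m ↔ t = m ∨ ∃ s ∈ S, s.castSucc = t := by
  simp [addMax]

theorem castSucc_mem_addMax {S : Finset (Fin n)} {m : Fin (n + 1)} {t : Fin n} :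
    t.castSucc ∈ addMax S m ↔ t.castSucc = m ∨ t ∈ S := by
  simp [addMax]

theorem card_addMax {S : Finset (Fin n)} (hS : S.card = q) {m : Fin (n + 1)}
    (hm : ∀ s ∈ S, s.castSucc < m) : (addMax S m).card = q + 1 := by
  rw [addMax, Finset.card_insert_of_notMem, Finset.card_map, hS]
  simp only [Finset.mem_map, not_exists, not_and]
  exact fun s hs h => (hm s hs).ne h

theorem shuffleSign_addMax (S : Finset (Fin n)) (m : Fin (n + 1))
    (hm : ∀ s ∈ S, s.castSucc < m) :
    shuffleSign (addMax S m) * (-1) ^ (((addMax S m)ᶜ.filter fun i => i < m).card)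
      = shuffleSign S := by
  have hmS : m ∉ S.map Fin.castSuccEmb := by
    simp only [Finset.mem_map, not_exists, not_and]
    exact fun s hs h => (hm s hs).ne h
  have hcard : ((addMax S m ×ˢ (addMax S m)ᶜ).filter fun x => x.2 < x.1).card
      = ((addMax S m)ᶜ.filter fun i => i < m).card
        + ((S ×ˢ Sᶜ).filter fun x => x.2 < x.1).card := by
    have hsplit : ((addMax S m ×ˢ (addMax S m)ᶜ).filter fun x => x.2 < x.1)
        = (((addMax S m)ᶜ.filter fun i => i < m).map ⟨fun i => (m, i), fun _ _ h => by simpa using h⟩)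
          ∪ (((S ×ˢ Sᶜ).filter fun x => x.2 < x.1).map
            (Fin.castSuccEmb.prodMap Fin.castSuccEmb)) := by
      ext ⟨a, b⟩
      simp only [Finset.mem_filter, Finset.mem_product, Finset.mem_compl, Finset.mem_union,
        Finset.mem_map, Prod.exists, Prod.mk.injEq,
        Function.Embedding.coe_prodMap, Prod.map, Fin.coe_castSuccEmb]
      constructor
      · rintro ⟨⟨ha, hb⟩, hab⟩
        rcases mem_addMax.1 ha with rfl | ⟨s, hs, rfl⟩
        · exact Or.inl ⟨b, ⟨hb, hab⟩, rfl⟩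
        · right
          obtain ⟨t, rfl⟩ : ∃ t : Fin n, t.castSucc = b :=
            ⟨b.castPred (ne_of_lt (hab.trans (Fin.castSucc_lt_last s))), by simp⟩
          rw [castSucc_mem_addMax, not_or] at hb
          exact ⟨s, t, ⟨⟨hs, hb.2⟩, by simpa using hab⟩, rfl, rfl⟩
      · rintro (⟨i, ⟨hi, him⟩, ⟨⟩⟩ | ⟨s, t, ⟨⟨hs, ht⟩, hst⟩, rfl, rfl⟩)
        · exact ⟨⟨mem_addMax.2 (Or.inl rfl), hi⟩, him⟩
        · refine ⟨⟨castSucc_mem_addMax.2 (Or.inr hs), ?_⟩, by simpa using hst⟩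
          rw [castSucc_mem_addMax, not_or]
          refine ⟨fun h => ?_, ht⟩
          have := hm s hs
          rw [← h] at this
          exact absurd hst (by simpa using this.le)
    rw [hsplit, Finset.card_union_of_disjoint, Finset.card_map, Finset.card_map]
    rw [Finset.disjoint_left]
    rintro ⟨a, b⟩ h1 h2
    simp only [Finset.mem_map, Finset.mem_filter, Finset.mem_product, Prod.exists,
      Prod.mk.injEq, Function.Embedding.coe_prodMap, Prod.map] at h1 h2
    obtain ⟨_, _, ⟨⟩⟩ := h1
    obtain ⟨s, t, ⟨⟨hs, _⟩, _⟩, h, _⟩ := h2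
    exact hmS (Finset.mem_map.2 ⟨s, hs, h⟩)
  rw [shuffleSign, hcard, pow_add, mul_right_comm, ← mul_pow, shuffleSign]
  simp

theorem orderEmb_addMax {S : Finset (Fin n)} (hS : S.card = q) {m : Fin (n + 1)}
    (hm : ∀ s ∈ S, s.castSucc < m) (hJ : (addMax S m).card = q + 1) :
    ⇑((addMax S m).orderEmbOfFin hJ)
      = Fin.snoc (α := fun _ => Fin (n + 1)) (fun b => (S.orderEmbOfFin hS b).castSucc) m := by
  symm
  refine Finset.orderEmbOfFin_unique hJ ?_ ?_
  · intro b
    induction b using Fin.lastCases with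
    | last => simp [mem_addMax]
    | cast b => simp [castSucc_mem_addMax]
  · intro a b hab
    induction b using Fin.lastCases with
    | last =>
      induction a using Fin.lastCases with
      | last => exact absurd hab (lt_irrefl _)
      | cast a => simpa using hm _ (Finset.orderEmbOfFin_mem S hS a)
    | cast b =>
      induction a using Fin.lastCases with
      | last => exact absurd (hab.trans (Fin.castSucc_lt_last b)) (lt_irrefl _)
      | cast a => simpa using hab

theorem orderEmb_compl_last (h : p + q = n) {S : Finset (Fin n)} (hS : S.card = q)
    (hJ : (addMax S (Fin.last n))ᶜ.card = p) (a : Fin p) :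
    (addMax S (Fin.last n))ᶜ.orderEmbOfFin hJ a
      = (Sᶜ.orderEmbOfFin (card_compl_of' h hS) a).castSucc := by
  refine (congrFun (Finset.orderEmbOfFin_unique hJ
    (f := fun a => (Sᶜ.orderEmbOfFin (card_compl_of' h hS) a).castSucc) ?_ ?_) a).symm
  · intro a
    have := Finset.orderEmbOfFin_mem Sᶜ (card_compl_of' h hS) a
    rw [Finset.mem_compl] at this
    rw [Finset.mem_compl, castSucc_mem_addMax, not_or]
    exact ⟨(Fin.castSucc_lt_last _).ne, this⟩
  · intro a b hab
    simpa using hab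

theorem orderEmb_compl_castSucc (h : p + q = n) {S : Finset (Fin n)} (hS : S.card = q)
    (a₀ : Fin p)
    (hJ : (addMax S (Sᶜ.orderEmbOfFin (card_compl_of' h hS) a₀).castSucc)ᶜ.card = p) (a : Fin p) :
    (addMax S (Sᶜ.orderEmbOfFin (card_compl_of' h hS) a₀).castSucc)ᶜ.orderEmbOfFin hJ a
      = if a < a₀ then (Sᶜ.orderEmbOfFin (card_compl_of' h hS) a).castSucc
        else if ha : (a : ℕ) + 1 < p then
          (Sᶜ.orderEmbOfFin (card_compl_of' h hS) ⟨a + 1, ha⟩).castSucc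
        else Fin.last n := by
  set e := Sᶜ.orderEmbOfFin (card_compl_of' h hS) with he
  refine (congrFun (Finset.orderEmbOfFin_unique hJ (f := fun a => if a < a₀ then (e a).castSucc
        else if ha : (a : ℕ) + 1 < p then (e ⟨a + 1, ha⟩).castSucc
        else Fin.last n) ?_ ?_) a).symm
  · have hmem : ∀ a, a ≠ a₀ → (e a).castSucc ∈ (addMax S (e a₀).castSucc)ᶜ := by
      intro a ha
      have := Finset.orderEmbOfFin_mem Sᶜ (card_compl_of' h hS) a
      rw [Finset.mem_compl] at this
      rw [Finset.mem_compl, castSucc_mem_addMax, not_or]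
      exact ⟨fun h => ha (by simpa using h), this⟩
    intro a
    split_ifs with h1 h2
    · exact hmem _ h1.ne
    · refine hmem _ fun h => h1 ?_
      rw [← h, Fin.lt_def]; simp
    · rw [Finset.mem_compl, mem_addMax, not_or]
      refine ⟨(Fin.castSucc_lt_last _).ne', ?_⟩
      rintro ⟨s, _, h⟩
      exact (Fin.castSucc_lt_last _).ne h
  · intro a b hab
    have hab' : (a : ℕ) < b := hab
    have he : ∀ {c d : Fin p}, (c : ℕ) < d → (e c).castSucc < (e d).castSucc := fun hcd =>
      Fin.castSucc_lt_castSucc_iff.2 (e.strictMono hcd)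
    simp only [Fin.lt_def (a := a), Fin.lt_def (a := b)]
    split_ifs
    all_goals first
      | exact Fin.castSucc_lt_last _
      | (refine he ?_; first | omega | (simp only; omega))
      | (exfalso; omega)

theorem card_compl_filter (h : p + q = n) {S : Finset (Fin n)} (hS : S.card = q) (a₀ : Fin p) :
    ((addMax S (Sᶜ.orderEmbOfFin (card_compl_of' h hS) a₀).castSucc)ᶜ.filter fun i =>
      i < (Sᶜ.orderEmbOfFin (card_compl_of' h hS) a₀).castSucc).card = a₀ := by
  set e := Sᶜ.orderEmbOfFin (card_compl_of' h hS) with he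
  have : ((addMax S (e a₀).castSucc)ᶜ.filter fun i => i < (e a₀).castSucc)
      = (Finset.Iio a₀).map (e.toEmbedding.trans Fin.castSuccEmb) := by
    ext t
    simp only [Finset.mem_filter, Finset.mem_compl, Finset.mem_map, Finset.mem_Iio,
      Function.Embedding.trans_apply, Fin.coe_castSuccEmb]
    constructor
    · rintro ⟨ht, hlt⟩
      obtain ⟨t, rfl⟩ : ∃ t' : Fin n, t'.castSucc = t :=
        ⟨t.castPred (ne_of_lt (hlt.trans (Fin.castSucc_lt_last _))), by simp⟩
      rw [castSucc_mem_addMax, not_or] at ht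
      obtain ⟨a, rfl⟩ : t ∈ Set.range e := by
        rw [he, Finset.range_orderEmbOfFin]; simpa using ht.2
      exact ⟨a, by simpa using hlt, rfl⟩
    · rintro ⟨a, ha, rfl⟩
      have hmem := Finset.orderEmbOfFin_mem Sᶜ (card_compl_of' h hS) a
      rw [Finset.mem_compl] at hmem
      change (e a).castSucc ∉ _ ∧ (e a).castSucc < _
      rw [castSucc_mem_addMax, not_or]
      exact ⟨⟨fun h => ha.ne (by simpa using h), hmem⟩, by simpa using ha⟩
  rw [this, Finset.card_map, Fin.card_Iio]

/-- `J = S ∪ {m}` with `m` larger than all elements of `S`. -/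
def maxEquivFun (x : Σ S : {S : Finset (Fin n) // S.card = q},
    {m : Fin (n + 1) // ∀ s ∈ S.1, s.castSucc < m}) :
    {J : Finset (Fin (n + 1)) // J.card = q + 1} :=
  ⟨addMax x.1.1 x.2.1, card_addMax x.1.2 x.2.2⟩

theorem maxEquivFun_bijective : Function.Bijective (maxEquivFun (q := q) (n := n)) := by
  constructor
  · rintro ⟨⟨S, hS⟩, ⟨m, hm⟩⟩ ⟨⟨S', hS'⟩, ⟨m', hm'⟩⟩ h
    have h : addMax S m = addMax S' m' := congrArg Subtype.val h
    have hmm : m = m' := by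
      have h1 : m ∈ addMax S' m' := h ▸ mem_addMax.2 (Or.inl rfl)
      have h2 : m' ∈ addMax S m := h ▸ mem_addMax.2 (Or.inl rfl)
      rcases mem_addMax.1 h1 with h1 | ⟨s, hs, rfl⟩
      · exact h1
      · rcases mem_addMax.1 h2 with h2 | ⟨t, ht, rfl⟩
        · exact h2.symm
        · exact absurd (hm' s hs) (hm t ht).not_gt
    subst hmm
    have hSS : S = S' := by
      ext t
      have := congrArg (t.castSucc ∈ ·) h
      simp only [castSucc_mem_addMax, eq_iff_iff] at this
      constructor
      · intro ht
        exact (this.1 (Or.inr ht)).resolve_left (hm t ht).ne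
      · intro ht
        exact (this.2 (Or.inr ht)).resolve_left (hm' t ht).ne
    subst hSS
    rfl
  · rintro ⟨J, hJ⟩
    have hne : J.Nonempty := Finset.card_pos.1 (by omega)
    set m := J.max' hne with hmdef
    have hmJ : m ∈ J := J.max'_mem hne
    set S : Finset (Fin n) := Finset.univ.filter fun t => t.castSucc ∈ J ∧ t.castSucc ≠ m with hSdef
    have hm : ∀ s ∈ S, s.castSucc < m := fun s hs => by
      have := (Finset.mem_filter.1 hs).2
      exact lt_of_le_of_ne (J.le_max' _ this.1) this.2
    have hJS : addMax S m = J := by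
      ext t
      rw [mem_addMax]
      constructor
      · rintro (rfl | ⟨s, hs, rfl⟩)
        · exact hmJ
        · exact (Finset.mem_filter.1 hs).2.1
      · intro ht
        by_cases htm : t = m
        · exact Or.inl htm
        · have hlt : t < m := lt_of_le_of_ne (J.le_max' _ ht) htm
          have htl : t ≠ Fin.last n := ne_of_lt (hlt.trans_le (Fin.le_last _))
          exact Or.inr ⟨t.castPred htl, by simp [hSdef, ht, htm], by simp⟩
    have hS : S.card = q := by
      have h1 := card_addMax (S := S) rfl hm
      rw [hJS, hJ] at h1
      omega
    exact ⟨⟨⟨S, hS⟩, ⟨m, hm⟩⟩, Subtype.ext hJS⟩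

end Reindex

variable {p q n : ℕ}

/-- The complement of `S`, listed in increasing order. -/
def complEmb (h : p + q = n) (S : {S : Finset (Fin n) // S.card = q}) : Fin p ↪o Fin n :=
  S.1ᶜ.orderEmbOfFin (card_compl_of' h S.2)

/-- The places of `Sᶜ` to the right of `S`. -/
def after (h : p + q = n) (S : {S : Finset (Fin n) // S.card = q}) : Finset (Fin p) :=
  Finset.univ.filter fun a => ∀ s ∈ S.1, s < complEmb h S a

theorem circTerm_last (h : p + q = n) (α : (Fin p → E × E) → E → E)
    (β : (Fin q → E × E) → E → E) (X : Fin n → E × E) (z : E)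
    (S : {S : Finset (Fin n) // S.card = q}) (hm : ∀ s ∈ S.1, s.castSucc < Fin.last n) :
    circTerm h α β X z ⟨addMax S.1 (Fin.last n), card_addMax S.2 hm⟩
      = shuffleSign S.1 • α (X ∘ complEmb h S) (β (X ∘ S.1.orderEmbOfFin S.2) z) := by
  have hk := shuffleSign_addMax S.1 _ hm
  have hk' : ((addMax S.1 (Fin.last n))ᶜ.filter fun i => i < Fin.last n).card = p := by
    rw [Finset.filter_true_of_mem, card_compl_of h (card_addMax S.2 hm)]
    intro i hi
    refine lt_of_le_of_ne (Fin.le_last _) ?_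
    rintro rfl
    exact (Finset.mem_compl.1 hi) (mem_addMax.2 (Or.inl rfl))
  rw [hk'] at hk
  unfold circTerm
  simp only [orderEmb_addMax S.2 hm, Fin.snoc_last, if_true, hk, Fin.snoc_castSucc,
    orderEmb_compl_last h S.2]
  rfl

theorem insertAt_complEmb {A : Type*} (h : p + q = n) (X : Fin n → A) (Y w : A)
    (S : {S : Finset (Fin n) // S.card = q}) (a₀ : Fin p)
    (hJ : (addMax S.1 (complEmb h S a₀).castSucc)ᶜ.card = p) :
    insertAt a₀ Y (fun a => (Fin.snoc X w : Fin (n + 1) → A)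
      ((addMax S.1 (complEmb h S a₀).castSucc)ᶜ.orderEmbOfFin hJ a))
      = update (X ∘ complEmb h S) a₀ Y := by
  funext a
  unfold insertAt
  simp only [complEmb, orderEmb_compl_castSucc h S.2]
  by_cases h1 : (a : ℕ) < a₀
  · have h1' : a < a₀ := h1
    rw [if_pos h1, if_pos h1', Fin.snoc_castSucc, update_of_ne h1'.ne]
    rfl
  · rw [if_neg h1]
    by_cases h2 : (a : ℕ) = a₀
    · obtain rfl : a = a₀ := Fin.ext h2
      simp
    · have h3 : a ≠ a₀ := fun h => h2 (congrArg _ h)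
      have h4 : ¬ ((⟨a - 1, (Nat.sub_le _ _).trans_lt a.2⟩ : Fin p) < a₀) := by
        simp only [Fin.lt_def]; omega
      have h5 : (a : ℕ) - 1 + 1 = a := by omega
      have h6 : (a : ℕ) - 1 + 1 < p := by omega
      rw [if_neg h2, if_neg h4, dif_pos h6, Fin.snoc_castSucc, update_of_ne h3]
      simp only [h5]
      rfl

theorem circTerm_castSucc (h : p + q = n) (α : (Fin p → E × E) → E → E)
    (β : (Fin q → E × E) → E → E) (X : Fin n → E × E) (z : E)
    (S : {S : Finset (Fin n) // S.card = q}) (a : Fin p)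
    (hm : ∀ s ∈ S.1, s.castSucc < (complEmb h S a).castSucc) :
    circTerm h α β X z ⟨addMax S.1 (complEmb h S a).castSucc, card_addMax S.2 hm⟩
      = shuffleSign S.1 •
        (α (update (X ∘ complEmb h S) a (β (X ∘ S.1.orderEmbOfFin S.2) (X (complEmb h S a)).1,
            (X (complEmb h S a)).2)) z
          + α (update (X ∘ complEmb h S) a ((X (complEmb h S a)).1,
            β (X ∘ S.1.orderEmbOfFin S.2) (X (complEmb h S a)).2)) z) := by
  have hk := shuffleSign_addMax S.1 _ hm
  have hk' : ((addMax S.1 (complEmb h S a).castSucc)ᶜ.filter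
      fun i => i < (complEmb h S a).castSucc).card = a := card_compl_filter h S.2 a
  unfold circTerm
  simp only [orderEmb_addMax S.2 hm, Fin.snoc_last, hk, Fin.snoc_castSucc,
    (Fin.castSucc_lt_last _).ne, if_false]
  simp only [hk', insertAt_complEmb h X]
  rfl

theorem circFun_eq (h : p + q = n) (α : (Fin p → E × E) → E → E)
    (β : (Fin q → E × E) → E → E) (X : Fin n → E × E) (z : E) :
    circFun h α β X z = ∑ S : {S : Finset (Fin n) // S.card = q}, shuffleSign S.1 •
      derivSum α β (after h S) (X ∘ complEmb h S) (X ∘ S.1.orderEmbOfFin S.2) z := by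
  classical
  unfold circFun
  rw [← Function.Bijective.sum_comp maxEquivFun_bijective, Fintype.sum_sigma]
  refine Finset.sum_congr rfl fun S _ => ?_
  set F : Fin (n + 1) → E := fun m => if hm : ∀ s ∈ S.1, s.castSucc < m then
    circTerm h α β X z ⟨addMax S.1 m, card_addMax S.2 hm⟩ else 0 with hF
  have h1 : ∑ m : {m : Fin (n + 1) // ∀ s ∈ S.1, s.castSucc < m},
      circTerm h α β X z (maxEquivFun ⟨S, m⟩) = ∑ m, F m := by
    refine Fintype.sum_of_injective Subtype.val Subtype.val_injective _ _ ?_ ?_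
    · intro m hm
      exact dif_neg fun h' => hm ⟨⟨m, h'⟩, rfl⟩
    · intro m
      have hFm : F m.1 = circTerm h α β X z ⟨addMax S.1 m.1, card_addMax S.2 m.2⟩ := dif_pos m.2
      exact hFm.symm
  rw [h1, Fin.sum_univ_castSucc, add_comm]
  have h2 : F (Fin.last n)
      = shuffleSign S.1 • α (X ∘ complEmb h S) (β (X ∘ S.1.orderEmbOfFin S.2) z) :=
    (dif_pos (fun s _ => Fin.castSucc_lt_last s)).trans
      (circTerm_last h α β X z S fun s _ => Fin.castSucc_lt_last s)
  have h3 : ∑ t : Fin n, F t.castSucc = ∑ a ∈ after h S, F (complEmb h S a).castSucc := by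
    have h4 : ∑ a, F (complEmb h S a).castSucc = ∑ t : Fin n, F t.castSucc := by
      refine Fintype.sum_of_injective (complEmb h S) (complEmb h S).injective _ _ ?_ fun _ => rfl
      intro t ht
      refine dif_neg fun h' => ?_
      rw [complEmb, Finset.range_orderEmbOfFin] at ht
      exact lt_irrefl _ (h' t (by simpa using ht))
    rw [← h4]
    refine (Finset.sum_subset (Finset.subset_univ _) fun a _ ha => dif_neg fun h' => ha ?_).symm
    exact Finset.mem_filter.2 ⟨Finset.mem_univ _, fun s hs =>
      Fin.castSucc_lt_castSucc_iff.1 (h' s hs)⟩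
  rw [h2, h3, derivSum, smul_add, Finset.smul_sum]
  refine congrArg _ (Finset.sum_congr rfl fun a ha => ?_)
  have hm : ∀ s ∈ S.1, s.castSucc < (complEmb h S a).castSucc := fun s hs =>
    Fin.castSucc_lt_castSucc_iff.2 ((Finset.mem_filter.1 ha).2 s hs)
  exact (dif_pos hm).trans (circTerm_castSucc h α β X z S a hm)

theorem isCochain_derivSum {α : (Fin p → E × E) → E → E} {β : (Fin q → E × E) → E → E}
    (h : p + q = n) (hα : IsCochain K α) (hβ : IsCochain K β)
    (S : {S : Finset (Fin n) // S.card = q}) :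
    IsCochain K fun X z =>
      derivSum α β (after h S) (X ∘ complEmb h S) (X ∘ S.1.orderEmbOfFin S.2) z := by
  set e := complEmb h S with he
  set f := S.1.orderEmbOfFin S.2 with hf
  have hef : ∀ a b, f b ≠ e a := fun a b hab => by
    have h1 := Finset.orderEmbOfFin_mem S.1 S.2 b
    have h2 := Finset.orderEmbOfFin_mem S.1ᶜ (card_compl_of' h S.2) a
    rw [Finset.mem_compl] at h2
    exact h2 (by rw [hf] at hab; exact hab ▸ h1)
  have hcases : ∀ i, (∃ b, f b = i) ∨ ∃ a, e a = i := fun i => by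
    by_cases hi : i ∈ S.1
    · left
      have : i ∈ Set.range f := by rw [hf, Finset.range_orderEmbOfFin]; exact hi
      exact this
    · right
      have : i ∈ Set.range e := by rw [he, complEmb, Finset.range_orderEmbOfFin]; simpa using hi
      exact this
  have hff : ∀ (X : Fin n → E × E) b v, update X (f b) v ∘ f = update (X ∘ f) b v :=
    fun X b v => update_comp_eq_of_injective _ f.injective _ _
  have hee : ∀ (X : Fin n → E × E) b v, update X (e b) v ∘ e = update (X ∘ e) b v :=
    fun X b v => update_comp_eq_of_injective _ e.injective _ _
  have hfe : ∀ (X : Fin n → E × E) b v, update X (f b) v ∘ e = X ∘ e :=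
    fun X b v => update_comp_eq_of_forall_ne _ _ fun a => (hef a b).symm
  have hef' : ∀ (X : Fin n → E × E) a v, update X (e a) v ∘ f = X ∘ f :=
    fun X a v => update_comp_eq_of_forall_ne _ _ fun b => hef a b
  constructor
  · intro X i y z
    rcases hcases i with ⟨b, rfl⟩ | ⟨a, rfl⟩
    · simp only [hff, hfe]
      exact hα.derivSum_linear_right _ _ _ _ fun w => hβ.linear_fst _ _ _ _
    · simp only [hee, hef']
      exact hα.derivSum_linear_fst hβ _ _ _ _ _ _
  · intro X i x z
    rcases hcases i with ⟨b, rfl⟩ | ⟨a, rfl⟩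
    · simp only [hff, hfe]
      exact hα.derivSum_linear_right _ _ _ _ fun w => hβ.linear_snd _ _ _ _
    · simp only [hee, hef']
      exact hα.derivSum_linear_snd hβ _ _ _ _ _ _
  · intro X
    exact hα.derivSum_linear_last hβ _ _ _
  · intro X i x z
    rcases hcases i with ⟨b, rfl⟩ | ⟨a, rfl⟩
    · simp only [hff, hfe]
      simp only [derivSum, hβ.alt, hα.zero_fst, hα.zero_snd, hα.zero_last, add_zero,
        Finset.sum_const_zero]
    · simp only [hee, hef']
      exact hα.derivSum_alt _ _ _ _ _ _
  · intro X i x y hi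
    rcases hcases i with ⟨b, rfl⟩ | ⟨a, rfl⟩
    · simp only [hff, hfe]
      have hb : (b : ℕ) + 1 = q := by
        by_contra hb
        have hlt : b < ⟨b + 1, by omega⟩ := by simp [Fin.lt_def]
        have := f.strictMono hlt
        rw [Fin.lt_def] at this
        omega
      have hP : after h S = ∅ := by
        refine Finset.filter_eq_empty_iff.2 fun a _ hs => ?_
        have := hs (f b) (Finset.orderEmbOfFin_mem S.1 S.2 b)
        rw [Fin.lt_def] at this
        omega
      simp only [derivSum, hP, hβ.alt_last _ _ _ _ hb, hα.zero_last, Finset.sum_empty, add_zero]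
    · simp only [hee, hef']
      have ha : (a : ℕ) + 1 = p := by
        by_contra ha
        have hlt : a < ⟨a + 1, by omega⟩ := by simp [Fin.lt_def]
        have := e.strictMono hlt
        rw [Fin.lt_def] at this
        omega
      refine hα.derivSum_alt_last _ _ _ _ ha (Finset.mem_filter.2 ⟨Finset.mem_univ _, ?_⟩) _ _
      intro s hs
      refine lt_of_le_of_ne (show s ≤ e a by rw [Fin.le_def]; omega) fun h' => ?_
      obtain ⟨b, hb⟩ : s ∈ Set.range f := by rw [hf, Finset.range_orderEmbOfFin]; exact hs
      exact hef a b (hb.trans h')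

theorem isCochain_circFun {α : (Fin p → E × E) → E → E} {β : (Fin q → E × E) → E → E}
    (h : p + q = n) (hα : IsCochain K α) (hβ : IsCochain K β) :
    IsCochain K (circFun h α β) := by
  have : circFun h α β = ∑ S : {S : Finset (Fin n) // S.card = q}, shuffleSign S.1 •
      fun X z => derivSum α β (after h S) (X ∘ complEmb h S) (X ∘ S.1.orderEmbOfFin S.2) z := by
    funext X z
    rw [circFun_eq]
    simp
  change circFun h α β ∈ Cochain K E n
  rw [this]
  exact sum_mem fun S _ => zsmul_mem (isCochain_derivSum h hα hβ S) _

/-- The product `∘ : C^p(E, E) × C^q(E, E) → C^{p+q}(E, E)`. -/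
def circ (h : p + q = n) (α : Cochain K E p) (β : Cochain K E q) : Cochain K E n :=
  ⟨circFun h α β, isCochain_circFun h α.2 β.2⟩

/-- The bracket `[α, β] = (-1)^{pq} α ∘ β - β ∘ α`, for `α ∈ C^p(E, E)` and `β ∈ C^q(E, E)`. -/
def bracket (h : p + q = n) (α : Cochain K E p) (β : Cochain K E q) : Cochain K E n :=
  (-1 : ℤ) ^ (p * q) • circ h α β - circ ((add_comm q p).trans h) β α

theorem derivSum_linear_snd_arg {α : (Fin p → E × E) → E → E} (hα : IsCochain K α)
    (P : Finset (Fin p)) (A : Fin p → E × E) (B : Fin q → E × E) (z : E) :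
    IsLinearMap K fun β : (Fin q → E × E) → E → E => derivSum α β P A B z := by
  constructor
  · intro v v'
    simp only [derivSum, Pi.add_apply, (hα.linear_last _).map_add,
      (hα.linear_fst _ _ _ _).map_add, (hα.linear_snd _ _ _ _).map_add, Finset.sum_add_distrib]
    abel
  · intro c v
    simp only [derivSum, Pi.smul_apply, (hα.linear_last _).map_smul,
      (hα.linear_fst _ _ _ _).map_smul, (hα.linear_snd _ _ _ _).map_smul, smul_add,
      Finset.smul_sum]

theorem isLinearMap_bracket (h : p + q = n) (α : Cochain K E p) :
    IsLinearMap K (bracket h α : Cochain K E q → Cochain K E n) := by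
  have h1 : IsLinearMap K (circ h α : Cochain K E q → Cochain K E n) := by
    constructor
    · intro β β'
      apply Subtype.ext
      funext X z
      change circFun h α.1 (β.1 + β'.1) X z = circFun h α.1 β.1 X z + circFun h α.1 β'.1 X z
      simp only [circFun_eq, (derivSum_linear_snd_arg α.2 _ _ _ _).map_add, smul_add,
        Finset.sum_add_distrib]
    · intro c β
      apply Subtype.ext
      funext X z
      change circFun h α.1 (c • β.1) X z = c • circFun h α.1 β.1 X z
      simp only [circFun_eq, (derivSum_linear_snd_arg α.2 _ _ _ _).map_smul, smul_comm _ c,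
        Finset.smul_sum]
  have h2 : IsLinearMap K (fun β : Cochain K E q => circ ((add_comm q p).trans h) β α) := by
    constructor
    · intro β β'
      apply Subtype.ext
      funext X z
      change circFun _ (β.1 + β'.1) α.1 X z = circFun _ β.1 α.1 X z + circFun _ β'.1 α.1 X z
      simp only [circFun_eq, ← Finset.sum_add_distrib, ← smul_add]
      refine Finset.sum_congr rfl fun S _ => congrArg _ ?_
      simp only [derivSum, Pi.add_apply, Finset.sum_add_distrib]
      abel
    · intro c β
      apply Subtype.ext
      funext X z
      change circFun _ (c • β.1) α.1 X z = c • circFun _ β.1 α.1 X z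
      simp only [circFun_eq, Finset.smul_sum, smul_comm c]
      refine Finset.sum_congr rfl fun S _ => congrArg _ ?_
      simp only [derivSum, Pi.smul_apply, smul_add, Finset.smul_sum]
  constructor
  · intro β β'
    unfold bracket
    rw [h1.map_add, h2.map_add, smul_add]
    abel
  · intro c β
    unfold bracket
    rw [h1.map_smul, h2.map_smul, smul_sub, smul_comm c]

end Cochains

section GeneralizedRepresentations

variable {K g V : Type*} [Field K] [AddCommGroup g] [Module K g] [AddCommGroup V] [Module K V]

theorem isCochain_one {E : Type*} [AddCommGroup E] [Module K E] (T : E → E → E → E)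
    (h₁ : ∀ y z, IsLinearMap K fun x => T x y z) (h₂ : ∀ x z, IsLinearMap K fun y => T x y z)
    (h₃ : ∀ x y, IsLinearMap K fun z => T x y z) (h₄ : ∀ x z, T x x z = 0)
    (h₅ : ∀ x y, T x y y = 0) :
    IsCochain K fun (X : Fin 1 → E × E) z => T (X 0).1 (X 0).2 z where
  linear_fst X i y z := by obtain rfl := Subsingleton.elim i 0; simpa using h₁ y z
  linear_snd X i x z := by obtain rfl := Subsingleton.elim i 0; simpa using h₂ x z
  linear_last X := h₃ _ _
  alt X i x z := by obtain rfl := Subsingleton.elim i 0; simpa using h₄ x z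
  alt_last X i x y _ := by obtain rfl := Subsingleton.elim i 0; simpa using h₅ x y

section Alt

variable {M N : Type*} [AddCommGroup M] [Module K M] [AddCommGroup N] [Module K N]

theorem alt2_left (f : M [⋀^Fin 2]→ₗ[K] N) (y : M) :
    IsLinearMap K fun x => f ![x, y] := by
  have e : ∀ w, update ![0, y] 0 w = ![w, y] := by
    intro w; ext k; fin_cases k <;> rfl
  constructor
  · intro w w'
    have h := f.map_update_add ![0, y] 0 w w'
    rwa [e, e, e] at h
  · intro c w
    have h := f.map_update_smul ![0, y] 0 c w
    rwa [e, e] at h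

theorem alt2_right (f : M [⋀^Fin 2]→ₗ[K] N) (x : M) :
    IsLinearMap K fun y => f ![x, y] := by
  have e : ∀ w, update ![x, 0] 1 w = ![x, w] := by
    intro w; ext k; fin_cases k <;> rfl
  constructor
  · intro w w'
    have h := f.map_update_add ![x, 0] 1 w w'
    rwa [e, e, e] at h
  · intro c w
    have h := f.map_update_smul ![x, 0] 1 c w
    rwa [e, e] at h

theorem alt2_self (f : M [⋀^Fin 2]→ₗ[K] N) (x : M) : f ![x, x] = 0 :=
  f.map_eq_zero_of_eq ![x, x] (i := 0) (j := 1) rfl (by decide)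

theorem alt2_skew (f : M [⋀^Fin 2]→ₗ[K] N) (x y : M) : f ![x, y] = -f ![y, x] := by
  have h := alt2_self f (x + y)
  rw [(alt2_left f _).map_add, (alt2_right f _).map_add, (alt2_right f _).map_add, alt2_self,
    alt2_self] at h
  exact eq_neg_of_add_eq_zero_left (by simpa using h)

theorem alt3_fst (f : M [⋀^Fin 3]→ₗ[K] N) (y z : M) :
    IsLinearMap K fun x => f ![x, y, z] := by
  have e : ∀ w, update ![0, y, z] 0 w = ![w, y, z] := by
    intro w; ext k; fin_cases k <;> rfl
  constructor
  · intro w w'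
    have h := f.map_update_add ![0, y, z] 0 w w'
    rwa [e, e, e] at h
  · intro c w
    have h := f.map_update_smul ![0, y, z] 0 c w
    rwa [e, e] at h

theorem alt3_snd (f : M [⋀^Fin 3]→ₗ[K] N) (x z : M) :
    IsLinearMap K fun y => f ![x, y, z] := by
  have e : ∀ w, update ![x, 0, z] 1 w = ![x, w, z] := by
    intro w; ext k; fin_cases k <;> rfl
  constructor
  · intro w w'
    have h := f.map_update_add ![x, 0, z] 1 w w'
    rwa [e, e, e] at h
  · intro c w
    have h := f.map_update_smul ![x, 0, z] 1 c w
    rwa [e, e] at h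

theorem alt3_trd (f : M [⋀^Fin 3]→ₗ[K] N) (x y : M) :
    IsLinearMap K fun z => f ![x, y, z] := by
  have e : ∀ w, update ![x, y, 0] 2 w = ![x, y, w] := by
    intro w; ext k; fin_cases k <;> rfl
  constructor
  · intro w w'
    have h := f.map_update_add ![x, y, 0] 2 w w'
    rwa [e, e, e] at h
  · intro c w
    have h := f.map_update_smul ![x, y, 0] 2 c w
    rwa [e, e] at h

end Alt

/-- The bracket `π` of `g`, extended to `g ⊕ V` by `π(x + u, y + v, z + w) = [x, y, z]`. -/
def piBar (V : Type*) [AddCommGroup V] [Module K V] (L : ThreeLieAlgebra K g) :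
    Cochain K (g × V) 1 :=
  ⟨fun X z => (L.br ![(X 0).1.1, (X 0).2.1, z.1], 0), by
    refine isCochain_one (fun x y z : g × V => (L.br ![x.1, y.1, z.1], (0 : V))) ?_ ?_ ?_ ?_ ?_
    · exact fun y z => ⟨fun x x' => by simp [(alt3_fst L.br _ _).map_add],
        fun c x => by simp [(alt3_fst L.br _ _).map_smul]⟩
    · exact fun y z => ⟨fun x x' => by simp [(alt3_snd L.br _ _).map_add],
        fun c x => by simp [(alt3_snd L.br _ _).map_smul]⟩
    · exact fun y z => ⟨fun x x' => by simp [(alt3_trd L.br _ _).map_add],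
        fun c x => by simp [(alt3_trd L.br _ _).map_smul]⟩
    · intro x z
      rw [L.br.map_eq_zero_of_eq ![x.1, x.1, z.1] (i := 0) (j := 1) rfl (by decide)]; rfl
    · intro x y
      rw [L.br.map_eq_zero_of_eq ![x.1, y.1, y.1] (i := 1) (j := 2) rfl (by decide)]; rfl⟩

/-- `ρ̄(x + u, y + v, z + w) = ρ(x, y)(w) + ρ(y, z)(u) + ρ(z, x)(v)`. -/
def rhoBar (ρ : g [⋀^Fin 2]→ₗ[K] Module.End K V) : Cochain K (g × V) 1 :=
  ⟨fun X z => (0, ρ ![(X 0).1.1, (X 0).2.1] z.2 + ρ ![(X 0).2.1, z.1] (X 0).1.2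
      + ρ ![z.1, (X 0).1.1] (X 0).2.2), by
    refine isCochain_one (fun x y z : g × V =>
      ((0 : g), ρ ![x.1, y.1] z.2 + ρ ![y.1, z.1] x.2 + ρ ![z.1, x.1] y.2)) ?_ ?_ ?_ ?_ ?_
    · exact fun y z => ⟨fun x x' => by
        simp [(alt2_left ρ _).map_add, (alt2_right ρ _).map_add]; abel,
        fun c x => by simp [(alt2_left ρ _).map_smul, (alt2_right ρ _).map_smul]⟩
    · exact fun y z => ⟨fun x x' => by
        simp [(alt2_left ρ _).map_add, (alt2_right ρ _).map_add]; abel,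
        fun c x => by simp [(alt2_left ρ _).map_smul, (alt2_right ρ _).map_smul]⟩
    · exact fun y z => ⟨fun x x' => by
        simp [(alt2_left ρ _).map_add, (alt2_right ρ _).map_add]; abel,
        fun c x => by simp [(alt2_left ρ _).map_smul, (alt2_right ρ _).map_smul]⟩
    · intro x z
      simp [alt2_self, alt2_skew ρ z.1 x.1]
    · intro x y
      simp [alt2_self, alt2_skew ρ y.1 x.1]⟩

/-- `ν̄(x + u, y + v, z + w) = ν(x)(v ∧ w) + ν(y)(w ∧ u) + ν(z)(u ∧ v)`. -/
def nuBar (ν : g →ₗ[K] V [⋀^Fin 2]→ₗ[K] V) : Cochain K (g × V) 1 :=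
  ⟨fun X z => (0, ν (X 0).1.1 ![(X 0).2.2, z.2] + ν (X 0).2.1 ![z.2, (X 0).1.2]
      + ν z.1 ![(X 0).1.2, (X 0).2.2]), by
    refine isCochain_one (fun x y z : g × V =>
      ((0 : g), ν x.1 ![y.2, z.2] + ν y.1 ![z.2, x.2] + ν z.1 ![x.2, y.2])) ?_ ?_ ?_ ?_ ?_
    · exact fun y z => ⟨fun x x' => by
        simp [(alt2_left (ν _) _).map_add, (alt2_right (ν _) _).map_add]; abel,
        fun c x => by simp [(alt2_left (ν _) _).map_smul, (alt2_right (ν _) _).map_smul]⟩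
    · exact fun y z => ⟨fun x x' => by
        simp [(alt2_left (ν _) _).map_add, (alt2_right (ν _) _).map_add]; abel,
        fun c x => by simp [(alt2_left (ν _) _).map_smul, (alt2_right (ν _) _).map_smul]⟩
    · exact fun y z => ⟨fun x x' => by
        simp [(alt2_left (ν _) _).map_add, (alt2_right (ν _) _).map_add]; abel,
        fun c x => by simp [(alt2_left (ν _) _).map_smul, (alt2_right (ν _) _).map_smul]⟩
    · intro x z
      simp [alt2_self, alt2_skew (ν x.1) z.2 x.2]
    · intro x y
      simp [alt2_self, alt2_skew (ν y.1) y.2 x.2]⟩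

/-- `π + ρ̄ + ν̄`. -/
def total (L : ThreeLieAlgebra K g) (ρ : g [⋀^Fin 2]→ₗ[K] Module.End K V)
    (ν : g →ₗ[K] V [⋀^Fin 2]→ₗ[K] V) : Cochain K (g × V) 1 :=
  piBar V L + rhoBar ρ + nuBar ν

/-- A generalized representation `(V; ρ, ν)` of the 3-Lie algebra `g` on `V`: the element
`π + ρ̄ + ν̄` of `C¹(g ⊕ V, g ⊕ V)` is a canonical structure, `[π + ρ̄ + ν̄, π + ρ̄ + ν̄] = 0`. -/
structure GeneralizedRep (L : ThreeLieAlgebra K g) (V : Type*) [AddCommGroup V] [Module K V] where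
  ρ : g [⋀^Fin 2]→ₗ[K] Module.End K V
  ν : g →ₗ[K] V [⋀^Fin 2]→ₗ[K] V
  canonical : bracket (p := 1) (q := 1) (n := 2) rfl (total L ρ ν) (total L ρ ν) = 0

/-- The cochains in `C^p(g ⊕ V, g ⊕ V)` with values in `V`, i.e. the space `C^p(g ⊕ V, V)`. -/
def CochainV (K g V : Type*) [Field K] [AddCommGroup g] [Module K g] [AddCommGroup V]
    [Module K V] (p : ℕ) : Submodule K (Cochain K (g × V) p) where
  carrier := {α | ∀ X z, (α.1 X z).1 = 0}
  zero_mem' _ _ := rfl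
  add_mem' := by
    intro α β hα hβ X z
    change (α.1 X z).1 + (β.1 X z).1 = 0
    rw [hα, hβ, add_zero]
  smul_mem' := by
    intro c α hα X z
    change c • (α.1 X z).1 = 0
    rw [hα, smul_zero]

/-- `C^p_>(g ⊕ V, V)`: the cochains in `C^p(g ⊕ V, V)` that vanish when all their `2p + 1`
arguments lie in `V`. This is the complement of `C^p(V, V)` in `C^p(g ⊕ V, V)`, the sum of
the components with at least one argument from `g` in the decomposition of `C^p(g ⊕ V, V)`
induced by that of `g ⊕ V` in each argument. -/
def CochainGt (K g V : Type*) [Field K] [AddCommGroup g] [Module K g] [AddCommGroup V]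
    [Module K V] (p : ℕ) : Submodule K (Cochain K (g × V) p) where
  carrier := {α | α ∈ CochainV K g V p ∧
    ∀ (X : Fin p → V × V) (z : V), α.1 (fun i => ((0, (X i).1), (0, (X i).2))) (0, z) = 0}
  zero_mem' := ⟨zero_mem _, fun _ _ => rfl⟩
  add_mem' := by
    intro α β hα hβ
    refine ⟨add_mem hα.1 hβ.1, fun X z => ?_⟩
    change α.1 _ _ + β.1 _ _ = 0
    rw [hα.2, hβ.2, add_zero]
  smul_mem' := by
    intro c α hα
    refine ⟨Submodule.smul_mem _ c hα.1, fun X z => ?_⟩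
    change c • α.1 _ _ = 0
    rw [hα.2, smul_zero]

theorem CochainGt.eq_zero {p : ℕ} {α : Cochain K (g × V) p} (hα : α ∈ CochainGt K g V p)
    (X : Fin p → (g × V) × (g × V)) (z : g × V)
    (hX : ∀ i, (X i).1.1 = 0 ∧ (X i).2.1 = 0) (hz : z.1 = 0) : α.1 X z = 0 := by
  have h := hα.2 (fun i => ((X i).1.2, (X i).2.2)) z.2
  convert h using 2
  · funext i
    exact Prod.ext (Prod.ext (hX i).1 rfl) (Prod.ext (hX i).2 rfl)
  · exact Prod.ext hz rfl

/-- `C^p(V, V)` inside `C^p(g ⊕ V, V)`: the cochains that depend only on the components in `V`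
of their arguments. -/
def CochainOfV (K g V : Type*) [Field K] [AddCommGroup g] [Module K g] [AddCommGroup V]
    [Module K V] (p : ℕ) : Submodule K (Cochain K (g × V) p) where
  carrier := {α | α ∈ CochainV K g V p ∧
    ∀ X z, α.1 X z = α.1 (fun i => ((0, (X i).1.2), (0, (X i).2.2))) (0, z.2)}
  zero_mem' := ⟨zero_mem _, fun _ _ => rfl⟩
  add_mem' := by
    intro α β hα hβ
    refine ⟨add_mem hα.1 hβ.1, fun X z => ?_⟩
    change α.1 _ _ + β.1 _ _ = α.1 _ _ + β.1 _ _
    rw [hα.2, hβ.2]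
  smul_mem' := by
    intro c α hα
    refine ⟨Submodule.smul_mem _ c hα.1, fun X z => ?_⟩
    change c • α.1 _ _ = c • α.1 _ _
    rw [hα.2]

/-- Extension by zero of the restriction of a cochain to `V`. -/
theorem isCochain_restrict {p : ℕ} {α : (Fin p → (g × V) × (g × V)) → g × V → g × V}
    (hα : IsCochain K α) :
    IsCochain K fun X z => α (fun i => ((0, (X i).1.2), (0, (X i).2.2))) (0, z.2) := by
  let P : (g × V) →ₗ[K] (g × V) := LinearMap.inr K g V ∘ₗ LinearMap.snd K g V
  let Q : (Fin p → (g × V) × (g × V)) → (Fin p → (g × V) × (g × V)) :=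
    fun X i => (P (X i).1, P (X i).2)
  have hQ : ∀ X i x y, Q (update X i (x, y)) = update (Q X) i (P x, P y) := by
    intro X i x y
    funext k
    by_cases hk : k = i
    · subst hk; simp [Q]
    · simp [Q, hk]
  change IsCochain K fun X z => α (Q X) (P z)
  constructor
  · intro X i y z
    simp only [hQ]
    exact (IsLinearMap.mk' _ (hα.linear_fst (Q X) i (P y) (P z)) ∘ₗ P).isLinear
  · intro X i y z
    simp only [hQ]
    exact (IsLinearMap.mk' _ (hα.linear_snd (Q X) i (P y) (P z)) ∘ₗ P).isLinear
  · intro X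
    exact (IsLinearMap.mk' _ (hα.linear_last (Q X)) ∘ₗ P).isLinear
  · intro X i x z
    simp only [hQ, hα.alt]
  · intro X i x y hi
    simp only [hQ, hα.alt_last _ _ _ _ hi]

/-- `C^p(g ⊕ V, V) = C^p_>(g ⊕ V, V) ⊕ C^p(V, V)`. -/
theorem cochain_decomposition (p : ℕ) :
    Disjoint (CochainGt K g V p) (CochainOfV K g V p) ∧
      CochainGt K g V p ⊔ CochainOfV K g V p = CochainV K g V p := by
  constructor
  · rw [Submodule.disjoint_def]
    intro α h1 h2
    apply Subtype.ext
    funext X z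
    rw [h2.2]
    exact h1.2 (fun i => ((X i).1.2, (X i).2.2)) z.2
  · apply le_antisymm
    · exact sup_le (fun α h => h.1) (fun α h => h.1)
    · intro α hα
      let r : Cochain K (g × V) p := ⟨_, isCochain_restrict α.2⟩
      have hr : r ∈ CochainOfV K g V p := ⟨fun X z => hα _ _, fun X z => rfl⟩
      rw [← sub_add_cancel α r]
      refine Submodule.add_mem_sup ⟨sub_mem hα hr.1, fun X z => ?_⟩ hr
      exact sub_self (α.1 (fun i => ((0, (X i).1), (0, (X i).2))) (0, z))

section Differential

variable (L : ThreeLieAlgebra K g) (ρ : g [⋀^Fin 2]→ₗ[K] Module.End K V)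
  (ν : g →ₗ[K] V [⋀^Fin 2]→ₗ[K] V)

theorem total_fst (X : Fin 1 → (g × V) × (g × V)) (z : g × V) :
    ((total L ρ ν).1 X z).1 = L.br ![(X 0).1.1, (X 0).2.1, z.1] := by
  change L.br ![(X 0).1.1, (X 0).2.1, z.1] + 0 + 0 = _
  simp

theorem total_eq_zero (X : Fin 1 → (g × V) × (g × V)) (z : g × V)
    (hX : ∀ i, (X i).1.1 = 0 ∧ (X i).2.1 = 0) (hz : z.1 = 0) : (total L ρ ν).1 X z = 0 := by
  refine Prod.ext ?_ ?_
  · rw [total_fst, hz]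
    exact (alt3_trd L.br _ _).map_zero
  · change 0 + (ρ ![(X 0).1.1, (X 0).2.1] z.2 + ρ ![(X 0).2.1, z.1] (X 0).1.2
      + ρ ![z.1, (X 0).1.1] (X 0).2.2) + (ν (X 0).1.1 ![(X 0).2.2, z.2]
      + ν (X 0).2.1 ![z.2, (X 0).1.2] + ν z.1 ![(X 0).1.2, (X 0).2.2]) = 0
    rw [(hX 0).1, (hX 0).2, hz]
    simp [alt2_self]

theorem bracket_mem_CochainGt {p : ℕ} {α : Cochain K (g × V) p} (hα : α ∈ CochainGt K g V p) :
    bracket (add_comm 1 p) (total L ρ ν) α ∈ CochainGt K g V (p + 1) := by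
  have hT := (total L ρ ν).2
  have h1 : circ (add_comm 1 p) (total L ρ ν) α ∈ CochainGt K g V (p + 1) := by
    refine ⟨fun X z => ?_, fun X z => ?_⟩
    · change (circFun _ (total L ρ ν).1 α.1 X z).1 = 0
      rw [circFun_eq, Prod.fst_sum]
      refine Finset.sum_eq_zero fun S _ => ?_
      rw [Prod.smul_fst, derivSum, Prod.fst_add, Prod.fst_sum, Finset.sum_eq_zero, total_fst,
        hα.1, (alt3_trd L.br _ _).map_zero, add_zero, smul_zero]
      intro a _
      obtain rfl := Subsingleton.elim a 0
      rw [Prod.fst_add, total_fst, total_fst]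
      simp only [update_self, hα.1 _ _, (alt3_fst L.br _ _).map_zero,
        (alt3_snd L.br _ _).map_zero, add_zero]
    · change circFun _ (total L ρ ν).1 α.1
        (fun i => ((0, (X i).1), (0, (X i).2))) (0, z) = 0
      rw [circFun_eq]
      refine Finset.sum_eq_zero fun S _ => ?_
      rw [derivSum, CochainGt.eq_zero hα _ _ (fun i => ⟨rfl, rfl⟩) rfl, hT.zero_last, zero_add,
        Finset.sum_eq_zero, smul_zero]
      intro a _
      rw [CochainGt.eq_zero hα _ _ (fun i => ⟨rfl, rfl⟩) rfl,
        CochainGt.eq_zero hα _ _ (fun i => ⟨rfl, rfl⟩) rfl, hT.zero_fst, hT.zero_snd, add_zero]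
  have h2 : circ rfl α (total L ρ ν) ∈ CochainGt K g V (p + 1) := by
    refine ⟨fun X z => ?_, fun X z => ?_⟩
    · change (circFun _ α.1 (total L ρ ν).1 X z).1 = 0
      rw [circFun_eq, Prod.fst_sum]
      refine Finset.sum_eq_zero fun S _ => ?_
      rw [Prod.smul_fst, derivSum, Prod.fst_add, Prod.fst_sum, Finset.sum_eq_zero,
        hα.1, add_zero, smul_zero]
      intro a _
      rw [Prod.fst_add, hα.1, hα.1, add_zero]
    · change circFun _ α.1 (total L ρ ν).1
        (fun i => ((0, (X i).1), (0, (X i).2))) (0, z) = 0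
      rw [circFun_eq]
      refine Finset.sum_eq_zero fun S _ => ?_
      rw [derivSum, total_eq_zero _ _ _ _ _ (fun i => ⟨rfl, rfl⟩) rfl, α.2.zero_last, zero_add,
        Finset.sum_eq_zero, smul_zero]
      intro a _
      rw [total_eq_zero _ _ _ _ _ (fun i => ⟨rfl, rfl⟩) rfl,
        total_eq_zero _ _ _ _ _ (fun i => ⟨rfl, rfl⟩) rfl, α.2.zero_fst, α.2.zero_snd, add_zero]
  exact sub_mem (zsmul_mem h1 _) h2

end Differential

namespace GeneralizedRep

variable {L : ThreeLieAlgebra K g} (R : GeneralizedRep L V)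

/-- The operator `d : C^p_>(g ⊕ V, V) → C^{p+1}_>(g ⊕ V, V)`, `d α = [π + ρ̄ + ν̄, α]`. -/
def d (p : ℕ) : CochainGt K g V p →ₗ[K] CochainGt K g V (p + 1) where
  toFun α := ⟨bracket (add_comm 1 p) (total L R.ρ R.ν) α.1, bracket_mem_CochainGt L R.ρ R.ν α.2⟩
  map_add' α β := Subtype.ext ((isLinearMap_bracket (add_comm 1 p) _).map_add α.1 β.1)
  map_smul' c α := Subtype.ext ((isLinearMap_bracket (add_comm 1 p) _).map_smul c α.1)

/-- The `(p + 1)`-cocycles, in the space `C^p_>(g ⊕ V, V)` of `(p + 1)`-cochains. -/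
def cocycles (p : ℕ) : Submodule K (CochainGt K g V p) := LinearMap.ker (R.d p)

/-- The `(p + 1)`-coboundaries. There are no `0`-cochains, so the only `1`-coboundary is `0`. -/
def coboundaries : (p : ℕ) → Submodule K (CochainGt K g V p)
  | 0 => ⊥
  | p + 1 => LinearMap.range (R.d p)

/-- The cohomology group in degree `p + 1`: cocycles modulo coboundaries. -/
abbrev cohomology (p : ℕ) : Type _ :=
  R.cocycles p ⧸ (R.coboundaries p).submoduleOf (R.cocycles p)

end GeneralizedRep

end GeneralizedRepresentations

end ThreeLie

universe u v w

/-! The point is the graded pre-Lie identity for `∘`: the associator (α∘β)∘γ - α∘(β∘γ) is symmetric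
in β and γ up to the sign (-1)^{qr}, where q and r are their degrees (`associator_symm`). Write T =
π + ρ̄ + ν̄, of degree 1. The condition [T, T] = 0 reads -2 T∘T = 0, so T∘T = 0. The identity for
(α, T, T) says that the associator is its own negative, whence (α∘T)∘T = 0. The identity for (T, α,
T) expresses (T∘α)∘T through T∘(α∘T) and T∘(T∘α). Substituting these in the expansion of [T, [T, α]]
makes everything cancel (`bracket_bracket_self`).

To prove the identity without manipulating triple shuffles, `∘` is characterized by how it behaves
when the first pair v is fixed. Write i_v for this contraction. By `circFun_eq`, α∘β is a signed sum
over the sets S of the q pairs given to β, and β then acts as a derivation on the arguments of α to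
the right of S. Splitting according to whether the first place belongs to S gives, for q ≥ 1,
i_v(α∘β) = α∘(i_vβ) + (-1)^q (i_vα)∘β. For q = 0 the first term is replaced by the action of β on
the two entries of v. Cochains extended by zero to lists of pairs turn this into a recursion,
`comp`, which agrees with the shuffle product by `ofTuple_circFun`. The pre-Lie identity follows by
induction on the list; only additivity in each argument and the degrees enter.

The rest is formal: d∘d = 0 puts coboundaries among cocycles and gives a cochain complex of modules,
whose homology is kernel modulo image. -/

namespace ThreeLie

open Function CategoryTheory

/-! ### The product on functions of lists, and the graded pre-Lie identity. -/

section ListCochains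

variable {E : Type*} [AddCommGroup E]

/-- The function obtained by fixing the first pair. -/
def contract (v : E × E) (α : List (E × E) → E → E) : List (E × E) → E → E := fun L => α (v :: L)

theorem contract_add (v : E × E) (α β : List (E × E) → E → E) :
    contract v (α + β) = contract v α + contract v β := rfl

theorem contract_sub (v : E × E) (α β : List (E × E) → E → E) :
    contract v (α - β) = contract v α - contract v β := rfl

theorem contract_zsmul (v : E × E) (c : ℤ) (α : List (E × E) → E → E) :
    contract v (c • α) = c • contract v α := rfl

/-- The product `∘` for functions of a list of pairs and a last argument, where `q` is the degree
of the second factor, by recursion on the list. -/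
def comp : ℕ → (List (E × E) → E → E) → (List (E × E) → E → E) → List (E × E) → E → E
  | 0, α, β, [], z => α [] (β [] z)
  -- There are too few pairs to fill the places of the second factor, so the sum over shuffles is
  -- empty.
  | _ + 1, _, _, [], _ => 0
  -- A factor of degree 0 consumes no pair and acts as a derivation: on the later arguments, then on
  -- either entry of v.
  | 0, α, β, v :: L, z => comp 0 (contract v α) β L z
      + (contract (β [] v.1, v.2) α L z + contract (v.1, β [] v.2) α L z)
  -- Either v becomes the first pair of β, or it stays with α and is moved past the q + 1 pairs of
  -- β. In the second case β cannot act on v, since it acts only to the right of its own pairs.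
  | q + 1, α, β, v :: L, z => comp q α (contract v β) L z
      + (-1 : ℤ) ^ (q + 1) • comp (q + 1) (contract v α) β L z

/-- In this form, as an identity of functions rather than of values, the recursion can be applied
inside nested products. -/
theorem contract_comp_zero (α β : List (E × E) → E → E) (v : E × E) :
    contract v (comp 0 α β) = comp 0 (contract v α) β
      + (contract (β [] v.1, v.2) α + contract (v.1, β [] v.2) α) := by
  funext L z; simp [comp, contract]

theorem contract_comp_succ (q : ℕ) (α β : List (E × E) → E → E) (v : E × E) :
    contract v (comp (q + 1) α β) = comp q α (contract v β)
      + (-1 : ℤ) ^ (q + 1) • comp (q + 1) (contract v α) β := by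
  funext L z; simp [comp, contract]

/-- Additivity in every argument. -/
structure IsMultiadditive (α : List (E × E) → E → E) : Prop where
  add_last (L : List (E × E)) (z z' : E) : α L (z + z') = α L z + α L z'
  add_fst (L : List (E × E)) (i : ℕ) (x x' y z : E) (hi : i < L.length) :
    α (L.set i (x + x', y)) z = α (L.set i (x, y)) z + α (L.set i (x', y)) z
  add_snd (L : List (E × E)) (i : ℕ) (x y y' z : E) (hi : i < L.length) :
    α (L.set i (x, y + y')) z = α (L.set i (x, y)) z + α (L.set i (x, y')) z

namespace IsMultiadditive

variable {α : List (E × E) → E → E}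

theorem contract (hα : IsMultiadditive α) (v : E × E) : IsMultiadditive (contract v α) where
  add_last L := hα.add_last (v :: L)
  add_fst L i x x' y z hi := hα.add_fst (v :: L) (i + 1) x x' y z (by simpa using hi)
  add_snd L i x y y' z hi := hα.add_snd (v :: L) (i + 1) x y y' z (by simpa using hi)

theorem contract_add_fst (hα : IsMultiadditive α) (x x' y : E) :
    ThreeLie.contract (x + x', y) α = ThreeLie.contract (x, y) α + ThreeLie.contract (x', y) α := by
  funext L z
  exact hα.add_fst ((0, 0) :: L) 0 x x' y z (by simp)

theorem contract_add_snd (hα : IsMultiadditive α) (x y y' : E) :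
    ThreeLie.contract (x, y + y') α = ThreeLie.contract (x, y) α + ThreeLie.contract (x, y') α := by
  funext L z
  exact hα.add_snd ((0, 0) :: L) 0 x y y' z (by simp)

end IsMultiadditive

theorem comp_add_left (q : ℕ) (α α' β : List (E × E) → E → E) :
    comp q (α + α') β = comp q α β + comp q α' β := by
  funext L
  induction L generalizing q α α' β with
  | nil => cases q <;> funext z <;> simp [comp]
  | cons v L ih =>
    change contract v _ L = contract v _ L
    cases q with
    | zero => simp only [contract_comp_zero, contract_add, Pi.add_apply, ih]; abel
    | succ q =>
      simp only [contract_comp_succ, contract_add, Pi.add_apply, Pi.smul_apply, ih, smul_add]; abel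

/-- Values of the second factor are substituted into arguments of `α`, so additivity of `α` is
needed here, unlike in `comp_add_left`. -/
theorem comp_add_right (q : ℕ) {α : List (E × E) → E → E} (hα : IsMultiadditive α)
    (β β' : List (E × E) → E → E) : comp q α (β + β') = comp q α β + comp q α β' := by
  funext L
  induction L generalizing q α β β' with
  | nil => cases q <;> funext z <;> simp [comp, hα.add_last]
  | cons v L ih =>
    change contract v _ L = contract v _ L
    cases q with
    | zero =>
      simp only [contract_comp_zero, contract_add, Pi.add_apply, ih _ (hα.contract v),
        hα.contract_add_fst, hα.contract_add_snd]
      abel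
    | succ q =>
      simp only [contract_comp_succ, contract_add, Pi.add_apply, Pi.smul_apply, ih _ hα,
        ih _ (hα.contract v), smul_add]
      abel

theorem comp_zsmul_left (q : ℕ) (c : ℤ) (α β : List (E × E) → E → E) :
    comp q (c • α) β = c • comp q α β :=
  map_zsmul (AddMonoidHom.mk' (fun α => comp q α β) fun α α' => comp_add_left q α α' β) c α

theorem comp_zsmul_right (q : ℕ) (c : ℤ) {α : List (E × E) → E → E} (hα : IsMultiadditive α)
    (β : List (E × E) → E → E) : comp q α (c • β) = c • comp q α β :=
  map_zsmul (AddMonoidHom.mk' (fun β => comp q α β) fun β β' => comp_add_right q hα β β') c β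

theorem comp_zero_left (q : ℕ) (β : List (E × E) → E → E) : comp q 0 β = 0 := by
  simpa using comp_zsmul_left q 0 0 β

theorem comp_zero_right (q : ℕ) {α : List (E × E) → E → E} (hα : IsMultiadditive α) :
    comp q α 0 = 0 := by
  simpa using comp_zsmul_right q 0 hα 0

/-- The associator of `∘`. -/
def associator (q r : ℕ) (α β γ : List (E × E) → E → E) : List (E × E) → E → E :=
  comp r (comp q α β) γ - comp (q + r) α (comp r β γ)

/-- Vanishing on lists whose length is not `q`. -/
def HasDegree (q : ℕ) (β : List (E × E) → E → E) : Prop := ∀ L, L.length ≠ q → β L = 0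

theorem HasDegree.contract_eq_zero {β : List (E × E) → E → E} (hβ : HasDegree 0 β) (v : E × E) :
    contract v β = 0 :=
  funext fun L => hβ (v :: L) (by simp)

theorem HasDegree.contract {q : ℕ} {β : List (E × E) → E → E} (hβ : HasDegree (q + 1) β)
    (v : E × E) : HasDegree q (contract v β) :=
  fun L hL => hβ (v :: L) (by simpa using hL)

/-- The terms in which β and γ are applied successively to the same entry of v cancel in the
associator. What remains besides the associator of `contract v α` is symmetric in β and γ. -/
theorem contract_associator_zero_zero (α β γ : List (E × E) → E → E) (v : E × E) :
    contract v (associator 0 0 α β γ) = associator 0 0 (contract v α) β γ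
      + (comp 0 (contract (β [] v.1, v.2) α) γ + comp 0 (contract (v.1, β [] v.2) α) γ
      + comp 0 (contract (γ [] v.1, v.2) α) β + comp 0 (contract (v.1, γ [] v.2) α) β
      + contract (γ [] v.1, β [] v.2) α + contract (β [] v.1, γ [] v.2) α) := by
  simp only [associator, Nat.add_zero, contract_sub, contract_comp_zero, comp_add_left]
  simp only [comp]
  abel

variable {α : List (E × E) → E → E}

/-- Together with `contract_associator_zero_succ` this covers the mixed degrees: the two right-hand
sides correspond under exchange of β and γ, term by term. -/
theorem contract_associator_succ_zero (hα : IsMultiadditive α) (β γ : List (E × E) → E → E)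
    (v : E × E) (q : ℕ) :
    contract v (associator (q + 1) 0 α β γ) = associator q 0 α (contract v β) γ
      + (-1 : ℤ) ^ (q + 1) • (associator (q + 1) 0 (contract v α) β γ
        + comp (q + 1) (contract (γ [] v.1, v.2) α) β
        + comp (q + 1) (contract (v.1, γ [] v.2) α) β) := by
  simp only [associator, Nat.add_zero, contract_sub, contract_comp_zero, contract_comp_succ,
    comp_add_left, comp_zsmul_left, comp_add_right _ hα, smul_add, smul_sub]
  abel

/-- Contracting β∘γ produces a term with `contract v β`, which would have no counterpart in
`contract_associator_succ_zero`; it vanishes because β has degree 0. -/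
theorem contract_associator_zero_succ (hα : IsMultiadditive α) {β : List (E × E) → E → E}
    (hβ : HasDegree 0 β) (γ : List (E × E) → E → E) (v : E × E) (r : ℕ) :
    contract v (associator 0 (r + 1) α β γ) = associator 0 r α β (contract v γ)
      + (-1 : ℤ) ^ (r + 1) • (associator 0 (r + 1) (contract v α) β γ
        + comp (r + 1) (contract (β [] v.1, v.2) α) γ
        + comp (r + 1) (contract (v.1, β [] v.2) α) γ) := by
  simp only [associator, Nat.zero_add, contract_sub, contract_comp_zero, contract_comp_succ,
    comp_add_left, comp_add_right _ hα, smul_add, smul_sub, hβ.contract_eq_zero, comp_zero_left,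
    smul_zero, comp_zero_right _ hα]
  abel

/-- The pair v goes to γ, to β or to α. The signs count the pairs of γ, or of both β and γ, that v
passes; in the last case there are (q + 1) + (r + 1) of them, of the same parity as q + r. -/
theorem contract_associator_succ_succ (hα : IsMultiadditive α) (β γ : List (E × E) → E → E)
    (v : E × E) (q r : ℕ) :
    contract v (associator (q + 1) (r + 1) α β γ)
      = associator (q + 1) r α β (contract v γ)
      + (-1 : ℤ) ^ (r + 1) • associator q (r + 1) α (contract v β) γ
      + (-1 : ℤ) ^ (q + r) • associator (q + 1) (r + 1) (contract v α) β γ := by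
  have e : q + 1 + (r + 1) = q + r + 1 + 1 := by omega
  have e' : q + 1 + r = q + r + 1 := by omega
  simp only [associator, e, e', ← Nat.add_assoc q r 1, contract_sub, contract_comp_succ,
    comp_add_left, comp_zsmul_left, comp_add_right _ hα, comp_zsmul_right _ _ hα, smul_add,
    smul_sub, smul_smul, ← pow_add]
  rw [show r + 1 + (q + 1) = q + r + 2 by omega, show q + r + 1 + 1 = q + r + 2 by omega,
    pow_add _ (q + r) 2, neg_one_sq, mul_one]
  abel

/-- The graded pre-Lie identity. -/
theorem associator_symm (q r : ℕ) (hα : IsMultiadditive α) {β γ : List (E × E) → E → E}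
    (hβ : HasDegree q β) (hγ : HasDegree r γ) :
    associator q r α β γ = (-1 : ℤ) ^ (q * r) • associator r q α γ β := by
  funext L
  induction L generalizing q r α β γ with
  -- On the empty list both associators vanish: for q = r = 0 the two bracketings have the same
  -- value, and otherwise a factor lacks arguments.
  | nil =>
    funext z
    cases q <;> cases r <;> simp [associator, comp, Nat.add_assoc, ← Nat.add_assoc _ _ 1]
  | cons v L ih =>
    change contract v (associator q r α β γ) L
      = contract v ((-1 : ℤ) ^ (q * r) • associator r q α γ β) L
    rw [contract_zsmul]
    cases q with
    | zero =>
      cases r with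
      | zero =>
        -- The leading associator is handled by induction, and the remaining terms are only
        -- permuted.
        simp only [contract_associator_zero_zero, Pi.add_apply, Pi.smul_apply,
          ih 0 0 (hα.contract v) hβ hγ, Nat.mul_zero, pow_zero, one_smul]
        abel
      | succ r =>
        simp only [contract_associator_zero_succ hα hβ, contract_associator_succ_zero hα,
          Pi.add_apply, Pi.smul_apply, ih 0 r hα hβ (hγ.contract v),
          ih 0 (r + 1) (hα.contract v) hβ hγ, Nat.zero_mul, pow_zero, one_smul]
    | succ q =>
      cases r with
      | zero =>
        simp only [contract_associator_zero_succ hα hγ, contract_associator_succ_zero hα,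
          Pi.add_apply, Pi.smul_apply, ih q 0 hα (hβ.contract v) hγ,
          ih (q + 1) 0 (hα.contract v) hβ hγ, Nat.mul_zero, pow_zero, one_smul]
      | succ r =>
        simp only [contract_associator_succ_succ hα, Pi.add_apply, Pi.smul_apply,
          ih (q + 1) r hα hβ (hγ.contract v), ih q (r + 1) hα (hβ.contract v) hγ,
          ih (q + 1) (r + 1) (hα.contract v) hβ hγ, smul_add, smul_smul, ← pow_add]
        -- Exchanging β and γ swaps the first two terms of `contract_associator_succ_succ`. The
        -- signs agree because (q + 1)(r + 1) + (q + 1) differs from (q + 1) r by an even number.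
        have h1 : (-1 : ℤ) ^ ((q + 1) * (r + 1) + (q + 1)) = (-1) ^ ((q + 1) * r) := by
          rw [show (q + 1) * (r + 1) + (q + 1) = (q + 1) * r + 2 * (q + 1) by ring, pow_add,
            pow_mul _ 2]
          simp
        rw [h1, show r + 1 + q * (r + 1) = (q + 1) * (r + 1) by ring, Nat.add_comm r q,
          Nat.add_comm (q + r), add_right_comm, add_comm (_ • associator (r + 1) q _ _ _ L)]
        abel

end ListCochains

/-! ### Subsets of places, split by whether they contain the first place. -/

section Shuffles

variable {p q n : ℕ}

/-- Counting inversions one element of J at a time isolates the contribution of the first place. -/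
theorem shuffleSign_eq_sum (J : Finset (Fin n)) :
    shuffleSign J = (-1) ^ ∑ j ∈ J, (Jᶜ.filter fun i => i < j).card := by
  unfold shuffleSign
  rw [Finset.card_filter, Finset.sum_product]
  simp only [Finset.card_filter]

theorem compl_map_succ (S : Finset (Fin n)) :
    (S.map (Fin.succEmb n))ᶜ = insert 0 (Sᶜ.map (Fin.succEmb n)) := by
  ext t
  induction t using Fin.cases with
  | zero => simp
  | succ t => simp [Fin.succ_ne_zero]

theorem compl_insert_zero (S : Finset (Fin n)) :
    (insert 0 (S.map (Fin.succEmb n)))ᶜ = Sᶜ.map (Fin.succEmb n) := by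
  rw [← compl_compl S, ← compl_map_succ, compl_compl, compl_compl]

theorem zero_notMem_map_succ (S : Finset (Fin n)) : (0 : Fin (n + 1)) ∉ S.map (Fin.succEmb n) := by
  simp

theorem card_filter_map_succ (S : Finset (Fin n)) (t : Fin n) :
    ((S.map (Fin.succEmb n)).filter fun i => i < t.succ).card = (S.filter fun i => i < t).card := by
  rw [Finset.filter_map, Finset.card_map]
  refine congrArg _ (Finset.filter_congr fun i _ => ?_)
  exact Fin.succ_lt_succ_iff

/-- The first place, when chosen, has nothing before it and creates no inversion. -/
theorem shuffleSign_insert_zero (S : Finset (Fin n)) :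
    shuffleSign (insert 0 (S.map (Fin.succEmb n))) = shuffleSign S := by
  rw [shuffleSign_eq_sum, shuffleSign_eq_sum, Finset.sum_insert (zero_notMem_map_succ S),
    compl_insert_zero, Finset.sum_map, Finset.filter_false_of_mem fun i _ => Fin.not_lt_zero i,
    Finset.card_empty, zero_add]
  refine congrArg _ (Finset.sum_congr rfl fun s _ => ?_)
  rw [Fin.coe_succEmb, card_filter_map_succ]

/-- The first place, now in the complement, precedes every element of S and adds one inversion for
each. This is the source of the sign in the recursion for `comp`. -/
theorem shuffleSign_map_succ (S : Finset (Fin n)) :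
    shuffleSign (S.map (Fin.succEmb n)) = (-1) ^ S.card * shuffleSign S := by
  rw [shuffleSign_eq_sum, shuffleSign_eq_sum, compl_map_succ, Finset.sum_map, ← pow_add]
  congr 1
  rw [Finset.card_eq_sum_ones, ← Finset.sum_add_distrib]
  refine Finset.sum_congr rfl fun s _ => ?_
  rw [Finset.filter_insert, if_pos (by simp), Finset.card_insert_of_notMem fun h =>
      zero_notMem_map_succ _ (Finset.mem_filter.1 h).1, Fin.coe_succEmb, card_filter_map_succ, add_comm]

theorem orderEmb_map_succ {S : Finset (Fin n)} (hS : S.card = q)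
    (hJ : (S.map (Fin.succEmb n)).card = q) :
    ⇑((S.map (Fin.succEmb n)).orderEmbOfFin hJ) = Fin.succ ∘ S.orderEmbOfFin hS := by
  refine (Finset.orderEmbOfFin_unique hJ (fun b => ?_) fun a b hab => ?_).symm
  · simp
  · simpa using hab

theorem orderEmb_insert_zero {S : Finset (Fin n)} (hS : S.card = q)
    (hJ : (insert 0 (S.map (Fin.succEmb n))).card = q + 1) :
    ⇑((insert 0 (S.map (Fin.succEmb n))).orderEmbOfFin hJ)
      = Fin.cons (α := fun _ => Fin (n + 1)) 0 (Fin.succ ∘ S.orderEmbOfFin hS) := by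
  refine (Finset.orderEmbOfFin_unique hJ (fun b => ?_) fun a b hab => ?_).symm
  · induction b using Fin.cases with
    | zero => simp
    | succ b => simp
  · induction b using Fin.cases with
    | zero => exact absurd hab (Fin.not_lt_zero a)
    | succ b =>
      induction a using Fin.cases with
      | zero => simp
      | succ a => simpa using hab

/-- `S`, moved one place to the right. -/
def shift (S : {S : Finset (Fin n) // S.card = q}) : {S : Finset (Fin (n + 1)) // S.card = q} :=
  ⟨S.1.map (Fin.succEmb n), (Finset.card_map _).trans S.2⟩

/-- `S`, moved one place to the right, together with the first place. -/
def shiftInsert (S : {S : Finset (Fin n) // S.card = q}) :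
    {S : Finset (Fin (n + 1)) // S.card = q + 1} :=
  ⟨insert 0 (S.1.map (Fin.succEmb n)), by
    rw [Finset.card_insert_of_notMem (zero_notMem_map_succ _), Finset.card_map, S.2]⟩

theorem map_succ_preimage {S : Finset (Fin (n + 1))} (h : 0 ∉ S) :
    (Finset.univ.filter fun t : Fin n => t.succ ∈ S).map (Fin.succEmb n) = S := by
  ext t
  induction t using Fin.cases with
  | zero => simp [h]
  | succ t => simp

theorem insert_zero_preimage {S : Finset (Fin (n + 1))} (h : 0 ∈ S) :
    insert 0 ((Finset.univ.filter fun t : Fin n => t.succ ∈ S).map (Fin.succEmb n)) = S := by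
  ext t
  induction t using Fin.cases with
  | zero => simp [h]
  | succ t => simp [Fin.succ_ne_zero]

theorem shift_injective : Function.Injective (shift (q := q) (n := n)) := fun _ _ h =>
  Subtype.ext (Finset.map_injective _ (congrArg Subtype.val h))

theorem shiftInsert_injective : Function.Injective (shiftInsert (q := q) (n := n)) := by
  intro S T h
  refine Subtype.ext (Finset.map_injective (Fin.succEmb n) ?_)
  have h' := congrArg (fun J => J.1.erase 0) h
  simpa [shiftInsert, Finset.erase_insert] using h'

theorem shift_surjective_of_zero_notMem (S : {S : Finset (Fin (n + 1)) // S.card = q})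
    (h : 0 ∉ S.1) : ∃ T, shift T = S :=
  ⟨⟨_, (Finset.card_map _).symm.trans ((congrArg _ (map_succ_preimage h)).trans S.2)⟩,
    Subtype.ext (map_succ_preimage h)⟩

/-- Pascal's rule for sums over subsets: a subset of n + 1 places either contains the first place or
is a shifted subset of the other n. -/
theorem sum_card_succ {M : Type*} [AddCommMonoid M]
    (F : {S : Finset (Fin (n + 1)) // S.card = q + 1} → M) :
    ∑ S, F S = ∑ S : {S : Finset (Fin n) // S.card = q}, F (shiftInsert S)
      + ∑ S : {S : Finset (Fin n) // S.card = q + 1}, F (shift S) := by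
  have hb : Function.Bijective (Sum.elim (shiftInsert (q := q) (n := n)) shift) := by
    constructor
    · refine shiftInsert_injective.sumElim shift_injective fun S T h => ?_
      have h0 : (0 : Fin (n + 1)) ∈ (shift T).1 := h ▸ Finset.mem_insert_self _ _
      exact zero_notMem_map_succ _ h0
    · intro S
      by_cases h : 0 ∈ S.1
      · have hS := congrArg Finset.card (insert_zero_preimage h)
        rw [Finset.card_insert_of_notMem (zero_notMem_map_succ _), Finset.card_map, S.2] at hS
        exact ⟨Sum.inl ⟨_, Nat.succ_injective hS⟩, Subtype.ext (insert_zero_preimage h)⟩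
      · obtain ⟨T, hT⟩ := shift_surjective_of_zero_notMem S h
        exact ⟨Sum.inr T, hT⟩
  rw [← hb.sum_comp, Fintype.sum_sum_type]
  rfl

theorem complEmb_shiftInsert (h : p + (q + 1) = n + 1) (h' : p + q = n)
    (S : {S : Finset (Fin n) // S.card = q}) :
    ⇑(complEmb h (shiftInsert S)) = Fin.succ ∘ complEmb h' S := by
  have hc := compl_insert_zero S.1
  unfold complEmb shiftInsert
  simp only [hc]
  exact orderEmb_map_succ _ _

theorem complEmb_shift (h : p + 1 + q = n + 1) (h' : p + q = n)
    (S : {S : Finset (Fin n) // S.card = q}) :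
    ⇑(complEmb h (shift S))
      = Fin.cons (α := fun _ => Fin (n + 1)) 0 (Fin.succ ∘ complEmb h' S) := by
  have hc := compl_map_succ S.1
  unfold complEmb shift
  simp only [hc]
  exact orderEmb_insert_zero _ _

theorem after_shiftInsert (h : p + (q + 1) = n + 1) (h' : p + q = n)
    (S : {S : Finset (Fin n) // S.card = q}) : after h (shiftInsert S) = after h' S := by
  unfold after
  simp only [complEmb_shiftInsert h h']
  simp [shiftInsert]

/-- Since S is nonempty, the first place is not to the right of S, so the second factor never acts
on the first pair. -/
theorem after_shift_succ (h : p + 1 + (q + 1) = n + 1) (h' : p + (q + 1) = n)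
    (S : {S : Finset (Fin n) // S.card = q + 1}) :
    after h (shift S) = (after h' S).map (Fin.succEmb p) := by
  have hne : S.1.Nonempty := Finset.card_pos.1 (by rw [S.2]; omega)
  obtain ⟨s, hs⟩ := hne
  unfold after
  simp only [complEmb_shift h h']
  ext a
  induction a using Fin.cases with
  | zero => simp [shift]; exact ⟨s, hs⟩
  | succ a => simp [shift]

/-- For empty S the condition is vacuous and the first place is included; this yields the two extra
terms of the recursion in degree 0. -/
theorem after_shift_zero (h : p + 1 + 0 = n + 1) (h' : p + 0 = n)
    (S : {S : Finset (Fin n) // S.card = 0}) :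
    after h (shift S) = insert 0 ((after h' S).map (Fin.succEmb p)) := by
  unfold after
  simp only [complEmb_shift h h']
  ext a
  induction a using Fin.cases with
  | zero => simp [shift, Finset.card_eq_zero.1 S.2]
  | succ a => simp [shift, Fin.succ_ne_zero]

end Shuffles

/-! ### The recursion for the shuffle product, and its agreement with the product on lists. -/

section FinCochains

variable {E : Type*} [AddCommGroup E] {p q n : ℕ}

/-- The function obtained by fixing the first pair. -/
def fixFirst (v : E × E) (α : (Fin (p + 1) → E × E) → E → E) : (Fin p → E × E) → E → E :=
  fun X => α (Fin.cons v X)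

theorem cons_comp_shiftInsert {A : Type*} (v : A) (X : Fin n → A)
    (S : {S : Finset (Fin n) // S.card = q}) :
    (Fin.cons v X : Fin (n + 1) → A) ∘ (shiftInsert S).1.orderEmbOfFin (shiftInsert S).2
      = Fin.cons v (X ∘ S.1.orderEmbOfFin S.2) := by
  rw [shiftInsert, orderEmb_insert_zero S.2]
  funext b
  induction b using Fin.cases <;> simp

theorem cons_comp_shift {A : Type*} (v : A) (X : Fin n → A)
    (S : {S : Finset (Fin n) // S.card = q}) :
    (Fin.cons v X : Fin (n + 1) → A) ∘ (shift S).1.orderEmbOfFin (shift S).2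
      = X ∘ S.1.orderEmbOfFin S.2 := by
  rw [shift, orderEmb_map_succ S.2]
  funext b
  simp

theorem derivSum_shiftInsert (h : p + (q + 1) = n + 1) (h' : p + q = n)
    (α : (Fin p → E × E) → E → E) (β : (Fin (q + 1) → E × E) → E → E) (v : E × E)
    (X : Fin n → E × E) (z : E) (S : {S : Finset (Fin n) // S.card = q}) :
    derivSum α β (after h (shiftInsert S)) (Fin.cons v X ∘ complEmb h (shiftInsert S))
        (Fin.cons v X ∘ (shiftInsert S).1.orderEmbOfFin (shiftInsert S).2) z
      = derivSum α (fixFirst v β) (after h' S) (X ∘ complEmb h' S)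
        (X ∘ S.1.orderEmbOfFin S.2) z := by
  rw [cons_comp_shiftInsert, after_shiftInsert h h', complEmb_shiftInsert h h']
  rfl

theorem cons_comp_complEmb_shift {A : Type*} (h : p + 1 + q = n + 1) (h' : p + q = n) (v : A)
    (X : Fin n → A) (S : {S : Finset (Fin n) // S.card = q}) :
    (Fin.cons v X : Fin (n + 1) → A) ∘ complEmb h (shift S) = Fin.cons v (X ∘ complEmb h' S) := by
  rw [complEmb_shift h h']
  funext b
  induction b using Fin.cases <;> simp

theorem derivSum_cons (α : (Fin (p + 1) → E × E) → E → E) (β : (Fin q → E × E) → E → E)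
    (P : Finset (Fin p)) (v : E × E) (A : Fin p → E × E) (B : Fin q → E × E) (z : E) :
    derivSum α β (P.map (Fin.succEmb p)) (Fin.cons v A) B z
      = derivSum (fixFirst v α) β P A B z := by
  unfold derivSum
  rw [Finset.sum_map]
  simp only [Fin.coe_succEmb, Fin.cons_succ, ← Fin.cons_update]
  rfl

theorem derivSum_cons_insert (α : (Fin (p + 1) → E × E) → E → E) (β : (Fin q → E × E) → E → E)
    (P : Finset (Fin p)) (v : E × E) (A : Fin p → E × E) (B : Fin q → E × E) (z : E) :
    derivSum α β (insert 0 (P.map (Fin.succEmb p))) (Fin.cons v A) B z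
      = derivSum (fixFirst v α) β P A B z
        + (fixFirst (β B v.1, v.2) α A z + fixFirst (v.1, β B v.2) α A z) := by
  rw [← derivSum_cons]
  unfold derivSum
  rw [Finset.sum_insert (zero_notMem_map_succ P)]
  simp only [Fin.cons_zero, Fin.update_cons_zero, fixFirst]
  abel

/-- Here n = q, so no set of q + 1 places avoids the first one, and only the term with the first
pair given to β survives. -/
theorem fixFirst_circFun_zero_succ (h : 0 + (q + 1) = n + 1) (h' : 0 + q = n)
    (α : (Fin 0 → E × E) → E → E) (β : (Fin (q + 1) → E × E) → E → E) (v : E × E) :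
    fixFirst v (circFun h α β) = circFun h' α (fixFirst v β) := by
  funext X z
  have : IsEmpty {S : Finset (Fin n) // S.card = q + 1} := ⟨fun S => by
    have := S.2 ▸ card_finset_fin_le S.1
    omega⟩
  rw [fixFirst, circFun_eq, circFun_eq, sum_card_succ,
    Fintype.sum_empty (ι := {S : Finset (Fin n) // S.card = q + 1}), add_zero]
  refine Finset.sum_congr rfl fun S _ => ?_
  rw [derivSum_shiftInsert h h', shiftInsert, shuffleSign_insert_zero]

/-- The two summands are the two halves of `sum_card_succ`: the sets S that contain the first place
and those that do not. -/
theorem fixFirst_circFun_succ_succ (h : p + 1 + (q + 1) = n + 1) (h₁ : p + 1 + q = n)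
    (h₂ : p + (q + 1) = n) (α : (Fin (p + 1) → E × E) → E → E)
    (β : (Fin (q + 1) → E × E) → E → E) (v : E × E) :
    fixFirst v (circFun h α β) = circFun h₁ α (fixFirst v β)
      + (-1 : ℤ) ^ (q + 1) • circFun h₂ (fixFirst v α) β := by
  funext X z
  rw [Pi.add_apply, Pi.add_apply, Pi.smul_apply, Pi.smul_apply, fixFirst, circFun_eq, circFun_eq,
    circFun_eq, sum_card_succ, Finset.smul_sum]
  congr 1
  · refine Finset.sum_congr rfl fun S _ => ?_
    rw [derivSum_shiftInsert h h₁, shiftInsert, shuffleSign_insert_zero]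
  · refine Finset.sum_congr rfl fun S _ => ?_
    rw [cons_comp_shift, cons_comp_complEmb_shift h h₂, after_shift_succ h h₂, derivSum_cons,
      shift, shuffleSign_map_succ, S.2, mul_smul]

theorem shuffleSign_of_card_eq_zero {S : Finset (Fin n)} (hS : S.card = 0) : shuffleSign S = 1 := by
  simp [Finset.card_eq_zero.1 hS, shuffleSign]

/-- The empty set is the only S of cardinality 0. Keeping it as a variable lets it be presented as
`shift S` when the first pair is split off. -/
theorem circFun_zero (h : p + 0 = n) (α : (Fin p → E × E) → E → E)
    (β : (Fin 0 → E × E) → E → E) (X : Fin n → E × E) (z : E) (S : {S : Finset (Fin n) // S.card = 0}) :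
    circFun h α β X z = derivSum α β (after h S) (X ∘ complEmb h S)
      (X ∘ S.1.orderEmbOfFin S.2) z := by
  have : Subsingleton {S : Finset (Fin n) // S.card = 0} := ⟨fun S T => Subtype.ext <| by
    rw [Finset.card_eq_zero.1 S.2, Finset.card_eq_zero.1 T.2]⟩
  rw [circFun_eq, Fintype.sum_subsingleton _ S, shuffleSign_of_card_eq_zero S.2, one_smul]

/-- By `after_shift_zero`, β also acts on the first pair. The family `B` is the unique empty one;
leaving it free, and transporting `X` along p = n, avoids committing to one form of these dependent
arguments. -/
theorem fixFirst_circFun_succ_zero (h : p + 1 + 0 = n + 1) (h' : p + 0 = n)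
    (α : (Fin (p + 1) → E × E) → E → E) (β : (Fin 0 → E × E) → E → E) (v : E × E)
    (X : Fin n → E × E) (hX : p = n) (B : Fin 0 → E × E) (z : E) :
    fixFirst v (circFun h α β) X z = circFun h' (fixFirst v α) β X z
      + (fixFirst (β B v.1, v.2) α (fun i => X (Fin.cast hX i)) z
        + fixFirst (v.1, β B v.2) α (fun i => X (Fin.cast hX i)) z) := by
  subst hX
  let S : {S : Finset (Fin p) // S.card = 0} := ⟨∅, rfl⟩
  have hS : ⇑(complEmb h' S) = id := by
    refine (Finset.orderEmbOfFin_unique _ (fun b => ?_) fun a b hab => hab).symm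
    simp [S]
  rw [fixFirst, circFun_zero _ _ _ _ _ (shift S), circFun_zero _ _ _ _ _ S, cons_comp_shift,
    cons_comp_complEmb_shift h h', after_shift_zero h h', derivSum_cons_insert,
    Subsingleton.elim B (X ∘ S.1.orderEmbOfFin S.2), hS]
  rfl

theorem circFun_zero_zero (h : 0 + 0 = 0) (α β : (Fin 0 → E × E) → E → E)
    (X : Fin 0 → E × E) (z : E) : circFun h α β X z = α X (β X z) := by
  rw [circFun_zero _ _ _ _ _ ⟨∅, rfl⟩, derivSum, Finset.eq_empty_of_isEmpty (after h _),
    Finset.sum_empty, add_zero]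
  exact congrArg₂ α (Subsingleton.elim _ _) (congrArg (β · z) (Subsingleton.elim _ _))

/-! ### Cochains as functions of lists -/

/-- The extension by zero of a cochain to a function of lists of pairs. -/
def ofTuple (α : (Fin p → E × E) → E → E) (L : List (E × E)) (z : E) : E :=
  if h : L.length = p then α (fun i => L.get (i.cast h.symm)) z else 0

theorem hasDegree_ofTuple (α : (Fin p → E × E) → E → E) : HasDegree p (ofTuple α) :=
  fun _ hL => funext fun _ => dif_neg hL

/-- A cochain is recovered by evaluating at `List.ofFn X`, so identities of cochains may be checked
on lists. -/
theorem ofTuple_injective : Function.Injective (ofTuple (E := E) (p := p)) := by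
  intro α β h
  funext X z
  have h' := congrFun (congrFun h (List.ofFn X)) z
  simpa [ofTuple] using h'

theorem ofTuple_add (α β : (Fin p → E × E) → E → E) : ofTuple (α + β) = ofTuple α + ofTuple β := by
  funext L z
  by_cases h : L.length = p <;> simp [ofTuple, h]

theorem ofTuple_zsmul (c : ℤ) (α : (Fin p → E × E) → E → E) :
    ofTuple (c • α) = c • ofTuple α := by
  funext L z
  by_cases h : L.length = p <;> simp [ofTuple, h]

theorem ofTuple_sub (α β : (Fin p → E × E) → E → E) : ofTuple (α - β) = ofTuple α - ofTuple β := by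
  funext L z
  by_cases h : L.length = p <;> simp [ofTuple, h]

theorem ofTuple_zero : ofTuple (0 : (Fin p → E × E) → E → E) = 0 := by
  funext L z
  by_cases h : L.length = p <;> simp [ofTuple, h]

theorem contract_ofTuple (v : E × E) (α : (Fin (p + 1) → E × E) → E → E) :
    contract v (ofTuple α) = ofTuple (fixFirst v α) := by
  funext L z
  by_cases h : L.length = p
  · simp only [contract, ofTuple, h, List.length_cons, dite_true, fixFirst]
    congr 1
    funext i
    induction i using Fin.cases <;> simp
  · simp [contract, ofTuple, h]

theorem contract_ofTuple_zero (v : E × E) (α : (Fin 0 → E × E) → E → E) :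
    contract v (ofTuple α) = 0 :=
  (hasDegree_ofTuple α).contract_eq_zero v

theorem isMultiadditive_ofTuple {K : Type*} [Field K] [Module K E]
    {α : (Fin p → E × E) → E → E} (hα : IsCochain K α) : IsMultiadditive (ofTuple α) := by
  have hset : ∀ (L : List (E × E)) (h : L.length = p) (i : ℕ) (hi : i < L.length) (w : E × E) (z : E),
      ofTuple α (L.set i w) z
        = α (update (fun i => L.get (i.cast h.symm)) ⟨i, h ▸ hi⟩ w) z := by
    intro L h i hi w z
    rw [ofTuple, dif_pos (by simpa using h)]
    congr 1
    funext k
    by_cases hk : k = ⟨i, h ▸ hi⟩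
    · subst hk; simp
    · have : i ≠ k := fun e => hk (Fin.ext e.symm)
      simp [hk, this]
  refine ⟨fun L z z' => ?_, fun L i x x' y z hi => ?_, fun L i x y y' z hi => ?_⟩
  · by_cases h : L.length = p
    · simp only [ofTuple, h, dite_true, (hα.linear_last _).map_add]
    · simp [ofTuple, h]
  · by_cases h : L.length = p
    · simp only [hset L h i hi, (hα.linear_fst _ _ _ _).map_add]
    · simp [ofTuple, h]
  · by_cases h : L.length = p
    · simp only [hset L h i hi, (hα.linear_snd _ _ _ _).map_add]
    · simp [ofTuple, h]

/-- Induction on the list: both sides obey the same contraction rule, the left one by splitting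
shuffles at the first place, the right one by definition. This transfers the pre-Lie identity to the
shuffle product. -/
theorem ofTuple_circFun (h : p + q = n) (α : (Fin p → E × E) → E → E)
    (β : (Fin q → E × E) → E → E) :
    ofTuple (circFun h α β) = comp q (ofTuple α) (ofTuple β) := by
  funext L
  induction L generalizing p q n with
  | nil =>
    funext z
    cases q with
    | zero =>
      cases p with
      | zero =>
        obtain rfl : n = 0 := by omega
        simp [ofTuple, comp, circFun_zero_zero]
      | succ p =>
        obtain ⟨n, rfl⟩ : ∃ m, n = m + 1 := ⟨n - 1, by omega⟩
        simp [ofTuple, comp]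
    | succ q =>
      obtain ⟨n, rfl⟩ : ∃ m, n = m + 1 := ⟨n - 1, by omega⟩
      simp [ofTuple, comp]
  | cons v L ih =>
    change contract v (ofTuple (circFun h α β)) L = contract v (comp q (ofTuple α) (ofTuple β)) L
    cases q with
    | zero =>
      rw [contract_comp_zero]
      cases p with
      | zero =>
        obtain rfl : n = 0 := by omega
        -- All factors have degree 0, so every contraction vanishes.
        simp only [contract_ofTuple_zero, comp_zero_left, add_zero]
      | succ p =>
        obtain ⟨n, rfl⟩ : ∃ m, n = m + 1 := ⟨n - 1, by omega⟩
        have h' : p + 0 = n := by omega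
        simp only [contract_ofTuple, Pi.add_apply, ← ih h']
        funext z
        have hpn : p = n := h'
        subst hpn
        -- In the right length this is the rule for tuples; in any other length every term is zero
        -- by the extension.
        by_cases hL : L.length = p
        · have hβ : ∀ z, ofTuple β [] z = β Fin.elim0 z := fun z =>
            congrArg (β · z) (Subsingleton.elim _ _)
          simp only [hβ, Pi.add_apply]
          simp only [ofTuple, hL, dite_true]
          exact fixFirst_circFun_succ_zero h h' α β v _ rfl _ z
        · simp [ofTuple, hL]
    | succ q =>
      obtain ⟨n, rfl⟩ : ∃ m, n = m + 1 := ⟨n - 1, by omega⟩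
      rw [contract_comp_succ]
      cases p with
      | zero =>
        have h' : 0 + q = n := by omega
        simp only [contract_ofTuple_zero, comp_zero_left, contract_ofTuple, smul_zero, add_zero,
          ← ih h', fixFirst_circFun_zero_succ h h']
      | succ p =>
        have h₁ : p + 1 + q = n := by omega
        have h₂ : p + (q + 1) = n := by omega
        simp only [contract_ofTuple, Pi.add_apply, Pi.smul_apply, ← ih h₁, ← ih h₂,
          fixFirst_circFun_succ_succ h h₁ h₂, ofTuple_add, ofTuple_zsmul]

end FinCochains

/-! ### Bracketing twice with a canonical structure gives zero. -/

section Square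

variable {K E : Type*} [Field K] [AddCommGroup E] [Module K E] {p q n : ℕ}

theorem ofTuple_bracket (h : p + q = n) (α : Cochain K E p) (β : Cochain K E q) :
    ofTuple (bracket h α β).1 = (-1 : ℤ) ^ (p * q) • comp q (ofTuple α.1) (ofTuple β.1)
      - comp p (ofTuple β.1) (ofTuple α.1) := by
  change ofTuple ((-1 : ℤ) ^ (p * q) • circFun h α.1 β.1 - circFun _ β.1 α.1) = _
  rw [ofTuple_sub, ofTuple_zsmul, ofTuple_circFun, ofTuple_circFun]

/-- For odd T this replaces the graded Jacobi identity: two instances of the pre-Lie identity,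
together with T∘T = 0, suffice. -/
theorem bracket_bracket_self [CharZero K] {T : Cochain K E 1}
    (hT : bracket (p := 1) (q := 1) (n := 2) rfl T T = 0) (α : Cochain K E p)
    (h : 1 + p = n) {m : ℕ} (h' : 1 + n = m) : bracket h' T (bracket h T α) = 0 := by
  -- Division by 2 is used twice, for T∘T and for (α∘T)∘T.
  have torsion : ∀ f : List (E × E) → E → E, f = -f → f = 0 := fun f hf => by
    have h2 : (2 : K) • f = 0 := by
      rw [two_smul]; nth_rewrite 1 [hf]; exact neg_add_cancel f
    exact (smul_eq_zero.1 h2).resolve_left two_ne_zero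
  subst h
  apply Subtype.ext
  apply ofTuple_injective
  have ht := isMultiadditive_ofTuple T.2
  have ha := isMultiadditive_ofTuple α.2
  have h1 := ofTuple_bracket (h := rfl) T T
  rw [ofTuple_bracket, ofTuple_bracket]
  rw [hT] at h1
  have e1 := associator_symm 1 1 ha (hasDegree_ofTuple T.1) (hasDegree_ofTuple T.1)
  have e2 := associator_symm p 1 ht (hasDegree_ofTuple α.1) (hasDegree_ofTuple T.1)
  generalize ofTuple T.1 = t at *
  generalize ofTuple α.1 = a at *
  have htt : comp 1 t t = 0 := torsion _ <| by
    change ofTuple 0 = _ at h1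
    rw [ofTuple_zero, mul_one, pow_one, neg_smul, one_smul] at h1
    exact (sub_eq_zero.1 h1.symm).symm
  have e3 : comp 1 (comp 1 a t) t = 0 := torsion _ <| by
    simpa [associator, htt, comp_zero_right _ ha] using e1
  -- With T∘T = 0 the identity becomes (T∘α)∘T - T∘(α∘T) = -(-1)^p T∘(T∘α), which is then solved for
  -- (T∘α)∘T.
  simp only [associator, htt, comp_zero_left, mul_one, zero_sub, Nat.add_comm p 1, smul_neg] at e2
  rw [sub_eq_iff_eq_add] at e2
  have e4 : comp 1 ((-1 : ℤ) ^ (1 * p) • comp p t a - comp 1 a t) t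
      = (-1 : ℤ) ^ p • comp 1 (comp p t a) t := by
    rw [sub_eq_add_neg, ← neg_one_zsmul (comp 1 a t), comp_add_left, comp_zsmul_left,
      comp_zsmul_left, e3, smul_zero, add_zero, one_mul]
  have e5 : comp (1 + p) t ((-1 : ℤ) ^ (1 * p) • comp p t a - comp 1 a t)
      = (-1 : ℤ) ^ p • comp (1 + p) t (comp p t a) - comp (1 + p) t (comp 1 a t) := by
    rw [sub_eq_add_neg, ← neg_one_zsmul (comp 1 a t), comp_add_right _ ht, comp_zsmul_right _ _ ht,
      comp_zsmul_right _ _ ht, one_mul, neg_one_zsmul, sub_eq_add_neg]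
  change _ = ofTuple 0
  -- After substitution T∘(α∘T) occurs with opposite coefficients ±(-1)^p, and T∘(T∘α) with -1 and
  -- (-1)^p (-1)^p = 1.
  rw [ofTuple_zero, e4, e5, e2, one_mul, pow_add, pow_one, smul_sub, smul_add, smul_neg]
  simp only [neg_mul, one_mul, neg_smul, smul_smul, ← mul_pow]
  simp

end Square

/-! ### Coboundaries are cocycles. -/

namespace GeneralizedRep

variable {K g V : Type*} [Field K] [CharZero K] [AddCommGroup g] [Module K g] [AddCommGroup V]
  [Module K V] {L : ThreeLieAlgebra K g} (R : GeneralizedRep L V)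

theorem d_comp_d (p : ℕ) : R.d (p + 1) ∘ₗ R.d p = 0 :=
  LinearMap.ext fun α => Subtype.ext <|
    bracket_bracket_self R.canonical α.1 (add_comm 1 p) (add_comm 1 (p + 1))

theorem coboundaries_le_cocycles (p : ℕ) : R.coboundaries p ≤ R.cocycles p := by
  cases p with
  | zero => exact bot_le
  | succ p => exact LinearMap.range_le_ker_iff.2 (R.d_comp_d p)

end GeneralizedRep

/-- The homology of a short complex of modules as the quotient of a kernel by an image. -/
noncomputable def homologyEquivKerModRange {K : Type u} [Ring K]
    (S : ShortComplex (ModuleCat.{v} K)) (B : Submodule K S.X₂) (hB : LinearMap.range S.f.hom = B) :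
    S.homology ≃ₗ[K]
      (LinearMap.ker S.g.hom ⧸ B.submoduleOf (LinearMap.ker S.g.hom)) :=
  S.moduleCatHomologyIso.toLinearEquiv ≪≫ₗ
    -- `moduleCatHomologyIso` divides by the range of `S.f` corestricted to the kernel of `S.g`;
    -- this is the preimage in that kernel of the range of `S.f`.
    Submodule.quotEquivOfEq _ _ (hB ▸ LinearMap.range_codRestrict (LinearMap.ker S.g.hom) S.f.hom
      S.moduleCat_zero_apply)

/-! ### The cochain complex of modules and its homology. -/

namespace GeneralizedRep

variable {K : Type u} {g : Type v} {V : Type w} [Field K] [CharZero K] [AddCommGroup g]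
  [Module K g] [AddCommGroup V] [Module K V] {L : ThreeLieAlgebra K g} (R : GeneralizedRep L V)

/-- The cochain complex of a generalized representation, with `C^p_>(g ⊕ V, V)` in degree `p`. -/
noncomputable def complex : CochainComplex (ModuleCat.{max w v} K) ℕ :=
  CochainComplex.of (fun p => ModuleCat.of K (CochainGt K g V p)) (fun p => ModuleCat.ofHom (R.d p))
    fun p => ModuleCat.hom_ext (R.d_comp_d p)

theorem complex_d (p : ℕ) : R.complex.d p (p + 1) = ModuleCat.ofHom (R.d p) :=
  CochainComplex.of_d (fun p => ModuleCat.of K (CochainGt K g V p))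
    (fun p => ModuleCat.ofHom (R.d p)) p

theorem range_complex_d (p : ℕ) :
    LinearMap.range (R.complex.d ((ComplexShape.up ℕ).prev p) p).hom = R.coboundaries p := by
  cases p with
  | zero =>
    -- In degree 0 the map `prev 0 → 0` joins unrelated degrees, hence is zero; its range matches
    -- the convention that only 0 is a coboundary there.
    rw [R.complex.shape _ _ (by simp)]
    exact LinearMap.range_zero
  | succ p =>
    rw [CochainComplex.prev_nat_succ, complex_d]
    rfl

theorem ker_complex_d (p : ℕ) : LinearMap.ker (R.complex.d p (p + 1)).hom = R.cocycles p := by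
  rw [complex_d]
  rfl

theorem nonempty_homology_equiv (p : ℕ) :
    Nonempty (R.complex.homology p ≃ₗ[K] R.cohomology p) := by
  -- Spelling the next degree as p + 1 makes the outgoing map the differential of `complex_d`. The
  -- previous degree stays as `prev p`, so that p = 0 needs no separate treatment here.
  have e := homologyEquivKerModRange (R.complex.sc' ((ComplexShape.up ℕ).prev p) p (p + 1))
    (R.coboundaries p) (R.range_complex_d p)
  have hk : LinearMap.ker (R.complex.sc' ((ComplexShape.up ℕ).prev p) p (p + 1)).g.hom
    = R.cocycles p := R.ker_complex_d p
  rw [hk] at e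
  exact ⟨(R.complex.homologyIsoSc' _ p (p + 1) rfl (by simp)).toLinearEquiv ≪≫ₗ e⟩

end GeneralizedRep
end ThreeLie

theorem mainTheorem3 {K : Type u} {g : Type v} {V : Type w}
    [Field K] [IsAlgClosed K] [CharZero K]
    [AddCommGroup g] [Module K g] [AddCommGroup V] [Module K V]
    (L : ThreeLieAlgebra K g) (R : ThreeLie.GeneralizedRep L V) :
    (∀ p : ℕ, R.d (p + 1) ∘ₗ R.d p = 0) ∧
    (∀ p : ℕ, R.coboundaries p ≤ R.cocycles p) ∧
    ∃ (C : CochainComplex (ModuleCat.{max w v} K) ℕ)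
      (φ : ∀ p : ℕ, C.X p ≃ₗ[K] ThreeLie.CochainGt K g V p),
      (∀ (p : ℕ) (c : C.X p), φ (p + 1) (C.d p (p + 1) c) = R.d p (φ p c)) ∧
      ∀ p : ℕ, Nonempty (C.homology p ≃ₗ[K] R.cohomology p) := by
  -- The identity serves as φ, because the degree p object of `R.complex` is the space of cochains
  -- by definition.
  refine ⟨R.d_comp_d, R.coboundaries_le_cocycles, R.complex,
    fun p => LinearEquiv.refl K (ThreeLie.CochainGt K g V p), fun p c => ?_,
    R.nonempty_homology_equiv⟩
  rw [R.complex_d]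
  rfl
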